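/- \textbf{Model.} There are $N$ users and infinitely many items, labelled by the natural numbers. All logarithms are to base $2$. Each user $u$ has a type $\tau_U(u)$ uniform on $\{1,\dots,q_U\}$, each item $i$ has a type $\tau_I(i)$ uniform on $\{1,\dots,q_I\}$, and $\Xi=(\xi_{w,j})$ is a $q_U\times q_I$ matrix with entries uniform on $\{-1,+1\}$; all these variables are mutually independent. User $u$ rates item $i$ with $L_{u,i}=\xi_{\tau_U(u),\tau_I(i)}$ ($+1$ is "like", $-1$ is "dislike"). At each time $t=1,2,\dots$ a recommendation algorithm recommends to every user $u$ (simultaneously) an item $a_{u,t}=f_{u,t}(\mathcal H_{t-1},\zeta_{u,t})$ and observes $L_{u,a_{u,t}}$, where $\mathcal H_{t-1}=(a_{v,s},L_{v,a_{v,s}})_{v\le N,\,s\le t-1}$ is the history, $f_{u,t}$ is a deterministic (measurable) function, and the random seeds $\zeta_{u,t}$ are mutually independent and independent of all the other variables. No item is recommended more than once to the same user. The regret is $$\mathrm{regret}(T)=\mathbb E\sum_{t=1}^{T}\frac1N\sum_{u=1}^{N}\mathbf 1[L_{u,a_{u,t}}=-1].$$ Put $\lfloor x\rfloor_+=\max\{0,\lfloor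 x\rfloor\}$ and $$s_U=\big\lfloor \log q_U-\log\log q_I-\log\log N-12\big\rfloor_+,\qquad s_I=\big\lfloor 0.99\log q_I-4\log\log N-12\big\rfloor_+ .$$ \textbf{Theorem.} There is a universal constant $c>0$ such that for all $N,q_U,q_I$ with $N>100$, $N>20\,q_U(\log q_U)^2$ and $q_U,q_I\ge 100\log N$, for every time horizon $T\ge 1$ and every recommendation algorithm, $$N\,\mathrm{regret}(T)\ \ge\ c\,\max\Big\{N,\ \min\{NT,\,N s_U,\,\sqrt{q_I}\},\ \min\{q_UT,\,\sqrt{q_I}\},\ \min\Big\{\frac{NT}{\log q_I},\,\sqrt{T q_I N},\,N s_U\Big\},\ \min\Big\{\frac{q_UT}{\log q_I},\,\sqrt{T q_I q_U}\Big\},\ \min\{T s_I,\,T q_U\}\Big\}.$$ -/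

import Mathlib

open MeasureTheory ProbabilityTheory
open scoped ENNReal

noncomputable section

namespace CollabFilter

/-- Binary feedback: `true` is "like" (the value `+1`), `false` is "dislike" (the value `-1`). -/
abbrev Rating : Type := Bool

/-- The data available to the algorithm before round `t`: for each of the rounds `0, …, t - 1`
and each of the `N` users, the item recommended and the rating received for it. Round `t : ℕ` is
the `(t + 1)`-st time step, and items are labelled by natural numbers. -/
abbrev History (N t : ℕ) : Type := Fin t → Fin N → ℕ × Rating

/-- A (possibly randomized) recommendation algorithm for `N` users: the item recommended to user
`u` in round `t` is a deterministic function of the history of the earlier rounds and of a private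
random seed with values in `Z`. -/
structure Algorithm (N : ℕ) (Z : Type*) [MeasurableSpace Z] where
  choose : Fin N → (t : ℕ) → History N t → Z → ℕ
  measurable_choose : ∀ (u : Fin N) (t : ℕ),
    Measurable (fun p : History N t × Z => choose u t p.1 p.2)

/-- The history produced before round `t` by an algorithm when user `u` rates item `i` with
`L u i` and the seeds are `z u t`. All users are served simultaneously in each round. -/
def Algorithm.history {N : ℕ} {Z : Type*} [MeasurableSpace Z] (A : Algorithm N Z)
    (L : Fin N → ℕ → Rating) (z : Fin N → ℕ → Z) : (t : ℕ) → History N t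
  | 0 => Fin.elim0
  | t + 1 =>
    let h := A.history L z t
    Fin.snoc (α := fun _ => Fin N → ℕ × Rating) h
      (fun u => (A.choose u t h (z u t), L u (A.choose u t h (z u t))))

/-- Labels of the elementary random variables of the model. -/
inductive Source (N qU qI : ℕ) : Type
  | user (u : Fin N)
  | item (i : ℕ)
  | entry (w : Fin qU) (j : Fin qI)
  | seed (u : Fin N) (t : ℕ)

/-- The σ-algebras generated by the individual user types, item types, entries of the preference
matrix, and algorithm seeds. -/
@[reducible]
def sourceSigma {N qU qI : ℕ} {Z Ω : Type*} [MeasurableSpace Z]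
    (userType : Fin N → Ω → Fin qU) (itemType : ℕ → Ω → Fin qI)
    (pref : Fin qU → Fin qI → Ω → Rating) (seed : Fin N → ℕ → Ω → Z) :
    Source N qU qI → MeasurableSpace Ω
  | .user u => MeasurableSpace.comap (userType u) inferInstance
  | .item i => MeasurableSpace.comap (itemType i) inferInstance
  | .entry w j => MeasurableSpace.comap (pref w j) inferInstance
  | .seed u t => MeasurableSpace.comap (seed u t) inferInstance

/-- The latent-type preference model on a probability space `(Ω, P)`: i.i.d. uniform user types in
a set of size `qU`, i.i.d. uniform item types in a set of size `qI`, a `qU × qI` preference matrix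
with i.i.d. fair `±1` entries, and algorithm seeds of arbitrary laws, all of these variables being
mutually independent. -/
structure Model (N qU qI : ℕ) (Z : Type*) [MeasurableSpace Z]
    {Ω : Type*} [MeasurableSpace Ω] (P : Measure Ω) where
  userType : Fin N → Ω → Fin qU
  itemType : ℕ → Ω → Fin qI
  pref : Fin qU → Fin qI → Ω → Rating
  seed : Fin N → ℕ → Ω → Z
  measurable_userType : ∀ u, Measurable (userType u)
  measurable_itemType : ∀ i, Measurable (itemType i)
  measurable_pref : ∀ w j, Measurable (pref w j)
  measurable_seed : ∀ u t, Measurable (seed u t)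
  userType_uniform : ∀ u w, P {ω | userType u ω = w} = (qU : ℝ≥0∞)⁻¹
  itemType_uniform : ∀ i j, P {ω | itemType i ω = j} = (qI : ℝ≥0∞)⁻¹
  pref_uniform : ∀ w j b, P {ω | pref w j ω = b} = 2⁻¹
  indep : iIndep (sourceSigma userType itemType pref seed) P

section Run

variable {N qU qI : ℕ} {Z : Type*} [MeasurableSpace Z] {Ω : Type*} [MeasurableSpace Ω]
  {P : Measure Ω}

/-- The rating `L_{u,i}` of item `i` by user `u`: the entry of the preference matrix at the type
of `u` and the type of `i`. -/
def Model.rating (M : Model N qU qI Z P) (u : Fin N) (i : ℕ) (ω : Ω) : Rating :=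
  M.pref (M.userType u ω) (M.itemType i ω) ω

/-- The item `a_{u,t}` recommended to user `u` in round `t`. -/
def recommended (M : Model N qU qI Z P) (A : Algorithm N Z) (u : Fin N) (t : ℕ) (ω : Ω) : ℕ :=
  A.choose u t (A.history (fun v i => M.rating v i ω) (fun v s => M.seed v s ω) t) (M.seed u t ω)

/-- Almost surely, no user is recommended the same item twice during the first `T` rounds. -/
def NoRepeat (M : Model N qU qI Z P) (A : Algorithm N Z) (T : ℕ) : Prop :=
  ∀ᵐ ω ∂P, ∀ u : Fin N, ∀ s t : ℕ, s < t → t < T →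
    recommended M A u s ω ≠ recommended M A u t ω

/-- The regret over `T` rounds: the expected number of disliked recommendations per user. -/
def regret (M : Model N qU qI Z P) (A : Algorithm N Z) (T : ℕ) : ℝ :=
  ∫ ω, ∑ t ∈ Finset.range T, (1 / (N : ℝ)) * ∑ u : Fin N,
    (if M.rating u (recommended M A u t ω) ω = false then (1 : ℝ) else 0) ∂P

end Run

/-- `s_U = ⌊log q_U - log log q_I - log log N - 12⌋₊`, with logarithms to base 2; `⌊x⌋₊` is
`max {0, ⌊x⌋}`. -/
def sU (N qU qI : ℕ) : ℕ :=
  ⌊Real.logb 2 qU - Real.logb 2 (Real.logb 2 qI) - Real.logb 2 (Real.logb 2 N) - 12⌋₊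

/-- `s_I = ⌊0.99 log q_I - 4 log log N - 12⌋₊`, with logarithms to base 2. -/
def sI (N qI : ℕ) : ℕ :=
  ⌊(99 / 100 : ℝ) * Real.logb 2 qI - 4 * Real.logb 2 (Real.logb 2 N) - 12⌋₊

/-- The right-hand side of the lower bound, without the numerical constant. -/
def lowerBound (N qU qI T : ℕ) : ℝ :=
  max (N : ℝ) <|
  max (min ((N : ℝ) * T) (min ((N : ℝ) * sU N qU qI) (√(qI : ℝ)))) <|
  max (min ((qU : ℝ) * T) (√(qI : ℝ))) <|
  max (min ((N : ℝ) * T / Real.logb 2 qI)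
    (min (√((T : ℝ) * qI * N)) ((N : ℝ) * sU N qU qI))) <|
  max (min ((qU : ℝ) * T / Real.logb 2 qI) (√((T : ℝ) * qI * qU))) <|
  min ((T : ℝ) * sI N qI) ((T : ℝ) * qU)

end CollabFilter

end

-- Fix the seeds. They are independent of the types and preferences, and ratings are binary, so
-- within `T` rounds the now deterministic algorithm can reach only finitely many items, say `B`.
-- Listing the `T * N` recommendations one after another turns it into an `Exploration` of the
-- matrix `ξ (σ x) (τ y)`, and expectations become averages over the finite set of all `Config`s,
-- which is uniformly distributed.
--
-- Ignorance is paid for in three ways. (a) The first inspection of a block reads a fair bit that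
-- nothing seen so far depends on, hence is disliked half the time: `sum_card_blocks_le`. (b) Let
-- `ξ` be `Balanced`. While user `x` has met fewer than `s` item types, the ratings in row `x` only
-- fix the pattern of the user type on those columns, and at least one eighth of the user types with
-- that pattern dislike a new item type: `sum_min_card_cols_le`. (c) The same holds with users and
-- items exchanged; for `s = 1` this charges every new item.
--
-- Since nothing is repeated to a user, every user meets `T` items, and it remains to see that this
-- forces many such inspections. Outside an event of probability at most one half, the following
-- hold as needed: `ξ` or its transpose is balanced (`card_not_balanced_le`), half of the user types
-- occur (`card_image_lt_le`), the first `√qI / 3` items have distinct types (`card_collides_le`),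
-- and if at most `M` items are used, every item type is shared by fewer than `R = 2 * M / qI + log
-- qI + 3` of them (`card_mult_le`). Thus a user meets `T` types if fewer than about `√qI` items are
-- in play, and at least `T / R` types if at most `M` are, whereas using more than `M` items costs
-- about `M` by (c). The choices `M = √(T * qI * N)` and `M = √(T * qI * qU)` balance the two costs.
-- Every term of the maximum comes from one such count, except `N`, which is the price of the blind
-- first round.

noncomputable section

namespace CollabFilter

open Finset

set_option linter.unusedSectionVars false

-- Resampling one coordinate

section Update

variable {X A : Type*} [Fintype X] [DecidableEq X] [Fintype A]

/-- Averaging over one coordinate does not change a sum over all functions. -/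
theorem sum_sum_update {R : Type*} [NonAssocSemiring R] (x : X) (F : (X → A) → R) :
    ∑ σ, ∑ a, F (Function.update σ x a) = Fintype.card A * ∑ σ, F σ := by
  classical
  have h : ∑ p : (X → A) × A, F (Function.update p.1 x p.2) = ∑ p : (X → A) × A, F p.1 := by
    refine Fintype.sum_equiv
      (Function.Involutive.toPerm (fun p : (X → A) × A => (Function.update p.1 x p.2, p.1 x)) ?_)
      _ _ ?_
    · rintro ⟨σ, a⟩
      simp
    · rintro ⟨σ, a⟩
      rfl
  rw [Fintype.sum_prod_type, Fintype.sum_prod_type] at h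
  rw [h, mul_sum]
  simp

end Update

/-- A deterministic sequential exploration of the cells of a binary matrix: the cell inspected at
a step depends only on the contents of the cells inspected before. -/
structure Exploration (X Y : Type*) where
  pair : ℕ → (X → Y → Bool) → X × Y
  causal : ∀ (L₁ L₂ : X → Y → Bool) (k : ℕ),
    (∀ l < k, L₁ (pair l L₁).1 (pair l L₁).2 = L₂ (pair l L₁).1 (pair l L₁).2) →
      pair k L₁ = pair k L₂

/-- The block matrix with row labels `σ`, column labels `τ` and block values `ξ`. -/
def blockRating {X Y A B : Type*} (σ : X → A) (τ : Y → B) (ξ : A → B → Bool) : X → Y → Bool :=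
  fun x y => ξ (σ x) (τ y)

/-- The number of rows of `ξ` that agree with the pattern `b` on the columns `J`. -/
def patternCount {A B : Type*} [Fintype A] (ξ : A → B → Bool) (J : Finset B) (b : B → Bool) :
    ℕ :=
  (univ.filter fun a => ∀ j ∈ J, ξ a j = b j).card

/-- Every pattern on at most `s` columns occurs in about as many rows as expected. -/
def Balanced {A B : Type*} [Fintype A] (ξ : A → B → Bool) (s : ℕ) : Prop :=
  ∀ J : Finset B, J.card ≤ s → ∀ b : B → Bool,
    Fintype.card A ≤ 2 * 2 ^ J.card * patternCount ξ J b ∧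
      2 ^ J.card * patternCount ξ J b ≤ 2 * Fintype.card A

-- Explorations and the cost of first inspections

namespace Exploration

variable {X Y A B : Type*} [DecidableEq X] [DecidableEq Y] [DecidableEq A] [DecidableEq B]

/-- The transposed exploration. -/
def swap (E : Exploration X Y) : Exploration Y X where
  pair k L := (E.pair k (fun x y => L y x)).swap
  causal L L' k h := by
    rw [E.causal (fun x y => L y x) (fun x y => L' y x) k]
    exact h

/-- The cells inspected during the first `k` steps. -/
def visited (E : Exploration X Y) (L : X → Y → Bool) (k : ℕ) : Finset (X × Y) :=
  (range k).image fun l => E.pair l L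

/-- The column labels seen in row `x` during the first `k` steps. -/
def cols (E : Exploration X Y) (τ : Y → B) (L : X → Y → Bool) (x : X) (k : ℕ) : Finset B :=
  ((E.visited L k).filter fun p => p.1 = x).image fun p => τ p.2

/-- The number of cells with value `false` inspected during the first `k` steps. -/
def dislikes (E : Exploration X Y) (L : X → Y → Bool) (k : ℕ) : ℕ :=
  ((range k).filter fun l => L (E.pair l L).1 (E.pair l L).2 = false).card

theorem visited_succ (E : Exploration X Y) (L : X → Y → Bool) (k : ℕ) :
    E.visited L (k + 1) = insert (E.pair k L) (E.visited L k) := by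
  simp [visited, range_add_one, image_insert]

theorem pair_mem_visited (E : Exploration X Y) (L : X → Y → Bool) {k l : ℕ} (h : l < k) :
    E.pair l L ∈ E.visited L k :=
  mem_image_of_mem _ (mem_range.2 h)

theorem visited_mono (E : Exploration X Y) (L : X → Y → Bool) {k l : ℕ} (h : k ≤ l) :
    E.visited L k ⊆ E.visited L l :=
  image_subset_image (range_mono h)

theorem pair_congr (E : Exploration X Y) {L L' : X → Y → Bool} {k l : ℕ}
    (h : ∀ p ∈ E.visited L k, L p.1 p.2 = L' p.1 p.2) (hl : l ≤ k) :
    E.pair l L = E.pair l L' :=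
  E.causal _ _ _ fun _ hm => h _ (E.pair_mem_visited L (hm.trans_le hl))

theorem visited_congr (E : Exploration X Y) {L L' : X → Y → Bool} {k : ℕ}
    (h : ∀ p ∈ E.visited L k, L p.1 p.2 = L' p.1 p.2) :
    E.visited L k = E.visited L' k :=
  image_congr fun _ hl => E.pair_congr h (mem_range.1 hl).le

theorem swap_visited (E : Exploration X Y) (L : X → Y → Bool) (k : ℕ) :
    E.swap.visited (fun y x => L x y) k = (E.visited L k).image Prod.swap := by
  simp only [visited, swap, image_image]
  rfl

theorem dislikes_mono (E : Exploration X Y) (L : X → Y → Bool) {k l : ℕ} (h : k ≤ l) :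
    E.dislikes L k ≤ E.dislikes L l :=
  card_le_card (filter_subset_filter _ (range_mono h))

theorem dislikes_eq_sum (E : Exploration X Y) (L : X → Y → Bool) (k : ℕ) :
    E.dislikes L k = ∑ l ∈ range k, if L (E.pair l L).1 (E.pair l L).2 = false then 1 else 0 := by
  rw [dislikes, card_filter]

theorem cols_succ (E : Exploration X Y) (τ : Y → B) (L : X → Y → Bool) (x : X) (k : ℕ) :
    E.cols τ L x (k + 1) = if (E.pair k L).1 = x then insert (τ (E.pair k L).2) (E.cols τ L x k)
      else E.cols τ L x k := by
  rw [cols, visited_succ, filter_insert]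
  split_ifs
  · rw [image_insert, cols]
  · rfl

/-- Telescoping: a step raises the capped count of its own row by one exactly when it brings a new
label while the cap is not reached. This turns a global count into a sum of one-step events. -/
theorem sum_min_card_cols [Fintype X] (E : Exploration X Y) (τ : Y → B) (L : X → Y → Bool)
    (s n : ℕ) :
    ∑ x, min (E.cols τ L x n).card s = ∑ k ∈ range n,
      if τ (E.pair k L).2 ∉ E.cols τ L (E.pair k L).1 k ∧ (E.cols τ L (E.pair k L).1 k).card < s
      then 1 else 0 := by
  induction n with
  | zero => simp [cols, visited]
  | succ n ih =>
    rw [sum_range_succ, ← ih]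
    have h : ∀ x, min (E.cols τ L x (n + 1)).card s = min (E.cols τ L x n).card s +
        if (E.pair n L).1 = x then
          if τ (E.pair n L).2 ∉ E.cols τ L (E.pair n L).1 n ∧
            (E.cols τ L (E.pair n L).1 n).card < s then 1 else 0
        else 0 := by
      intro x
      rw [cols_succ]
      by_cases hx : (E.pair n L).1 = x
      · subst hx
        simp only [if_true]
        by_cases hm : τ (E.pair n L).2 ∈ E.cols τ L (E.pair n L).1 n
        · simp [hm]
        · rw [card_insert_of_notMem hm]
          by_cases hs : (E.cols τ L (E.pair n L).1 n).card < s
          · simp only [hm, hs, not_false_eq_true, and_self, if_true]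
            omega
          · simp only [hs, and_false, if_false]
            omega
      · simp [hx]
    rw [sum_congr rfl fun x _ => h x, sum_add_distrib]
    simp

/-- The labels of the blocks inspected during the first `k` steps. -/
def blocks (E : Exploration X Y) (σ : X → A) (τ : Y → B) (L : X → Y → Bool) (k : ℕ) :
    Finset (A × B) :=
  (E.visited L k).image (Prod.map σ τ)

theorem card_blocks (E : Exploration X Y) (σ : X → A) (τ : Y → B) (L : X → Y → Bool) (n : ℕ) :
    (E.blocks σ τ L n).card = ∑ k ∈ range n,
      if Prod.map σ τ (E.pair k L) ∉ E.blocks σ τ L k then 1 else 0 := by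
  induction n with
  | zero => simp [blocks, visited]
  | succ n ih =>
    rw [sum_range_succ, ← ih, blocks, visited_succ, image_insert, ← blocks]
    by_cases h : Prod.map σ τ (E.pair n L) ∈ E.blocks σ τ L n
    · simp [h]
    · rw [card_insert_of_notMem h, if_pos h]

section Fresh

variable [Fintype A] [Fintype B]

/-- Setting the entry of the fresh block to `false` does not affect the first `k` steps, which never
read it. This maps the matrices with a fresh liked block injectively into those with a fresh
disliked block. -/
theorem card_fresh_block_le (E : Exploration X Y) (σ : X → A) (τ : Y → B) (k : ℕ) :
    (univ.filter fun ξ : A → B → Bool => Prod.map σ τ (E.pair k (blockRating σ τ ξ)) ∉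
        E.blocks σ τ (blockRating σ τ ξ) k).card ≤
      2 * (univ.filter fun ξ : A → B → Bool => Prod.map σ τ (E.pair k (blockRating σ τ ξ)) ∉
        E.blocks σ τ (blockRating σ τ ξ) k ∧ blockRating σ τ ξ
          (E.pair k (blockRating σ τ ξ)).1 (E.pair k (blockRating σ τ ξ)).2 = false).card := by
  classical
  set S := univ.filter fun ξ : A → B → Bool => Prod.map σ τ (E.pair k (blockRating σ τ ξ)) ∉
    E.blocks σ τ (blockRating σ τ ξ) k with hS
  let D : (A → B → Bool) → Prop := fun ξ => blockRating σ τ ξ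
          (E.pair k (blockRating σ τ ξ)).1 (E.pair k (blockRating σ τ ξ)).2 = false
  have h1 : (univ.filter fun ξ : A → B → Bool => Prod.map σ τ (E.pair k (blockRating σ τ ξ)) ∉
      E.blocks σ τ (blockRating σ τ ξ) k ∧ blockRating σ τ ξ
        (E.pair k (blockRating σ τ ξ)).1 (E.pair k (blockRating σ τ ξ)).2 = false) =
      S.filter D := by
    rw [hS, filter_filter]
  rw [h1, ← card_filter_add_card_filter_not (s := S) D, two_mul]
  refine Nat.add_le_add_left ?_ _
  let c : (A → B → Bool) → A × B := fun ξ => Prod.map σ τ (E.pair k (blockRating σ τ ξ))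
  let g : A × B → Bool → (A → B → Bool) → (A → B → Bool) := fun e v ξ a b =>
    if (a, b) = e then v else ξ a b
  have key : ∀ ξ ∈ S, ∀ v, E.pair k (blockRating σ τ ξ) =
      E.pair k (blockRating σ τ (g (c ξ) v ξ)) ∧
      E.visited (blockRating σ τ ξ) k = E.visited (blockRating σ τ (g (c ξ) v ξ)) k := by
    intro ξ hξ v
    have hag : ∀ p ∈ E.visited (blockRating σ τ ξ) k, blockRating σ τ ξ p.1 p.2 =
        blockRating σ τ (g (c ξ) v ξ) p.1 p.2 := by
      intro p hp
      have : (σ p.1, τ p.2) ≠ c ξ := by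
        intro he
        refine (mem_filter.1 hξ).2 ?_
        change c ξ ∈ _
        rw [← he]
        exact mem_image_of_mem (Prod.map σ τ) hp
      simp [blockRating, g, this]
    exact ⟨E.pair_congr hag le_rfl, E.visited_congr hag⟩
  refine card_le_card_of_injOn (fun ξ => g (c ξ) false ξ) ?_ ?_
  · intro ξ hξ
    simp only [coe_filter, Set.mem_ofPred_eq] at hξ
    have hk := key ξ hξ.1 false
    simp only [coe_filter, Set.mem_ofPred_eq]
    refine ⟨?_, ?_⟩
    · rw [hS, mem_filter, blocks, ← hk.1, ← hk.2]
      exact ⟨mem_univ _, (mem_filter.1 hξ.1).2⟩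
    · change blockRating σ τ _ _ _ = false
      rw [← hk.1]
      simp [blockRating, g, c, Prod.map]
  · intro ξ hξ ξ' hξ' he
    simp only [coe_filter, Set.mem_ofPred_eq] at hξ hξ'
    have hk := key ξ hξ.1 false
    have hk' := key ξ' hξ'.1 false
    simp only at he
    have hc : c ξ = c ξ' := by
      change Prod.map σ τ _ = Prod.map σ τ _
      rw [hk.1, hk'.1, he]
    -- The overwritten entry was `true` in both matrices, so the overwriting loses no information.
    have ht : ∀ ζ, ¬ D ζ → ζ (c ζ).1 (c ζ).2 = true := by
      intro ζ hζ
      simpa [D, blockRating, c] using hζ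
    funext a b
    by_cases hab : (a, b) = c ξ
    · have e1 := ht ξ hξ.2
      have e2 := ht ξ' hξ'.2
      rw [← hc, ← hab] at e2
      rw [← hab] at e1
      exact e1.trans e2.symm
    · have := congrFun (congrFun he a) b
      simpa [g, hab, ← hc] using this

/-- Every newly inspected block is disliked with probability one half. -/
theorem sum_card_blocks_le (E : Exploration X Y) (σ : X → A) (τ : Y → B) (n : ℕ) :
    ∑ ξ : A → B → Bool, (E.blocks σ τ (blockRating σ τ ξ) n).card ≤
      2 * ∑ ξ : A → B → Bool, E.dislikes (blockRating σ τ ξ) n := by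
  simp_rw [card_blocks, dislikes_eq_sum]
  rw [sum_comm, sum_comm (s := univ) (t := range n), mul_sum]
  refine sum_le_sum fun k _ => ?_
  rw [← card_filter, ← card_filter]
  refine (E.card_fresh_block_le σ τ k).trans (Nat.mul_le_mul_left 2 (card_le_card ?_))
  exact fun ξ hξ => mem_filter.2 ⟨mem_univ _, (mem_filter.1 hξ).2.2⟩

end Fresh

-- Fresh column labels in a balanced matrix

section FreshColumn

variable [Fintype X] [Fintype A]

/-- Only the type `a` of row `x` varies. The types split into classes that the first `k` steps
cannot tell apart. The event is constant on each class, and balancedness compares the size of a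
class with the part of it that dislikes the new label. -/
theorem card_fresh_col_row_le (E : Exploration X Y) (τ : Y → B) (ξ : A → B → Bool) {s : ℕ}
    (hξ : Balanced ξ s) (k : ℕ) (x : X) (σ : X → A) :
    (univ.filter fun a : A =>
      let L := blockRating (Function.update σ x a) τ ξ
      (E.pair k L).1 = x ∧ τ (E.pair k L).2 ∉ E.cols τ L x k ∧ (E.cols τ L x k).card < s).card ≤
    8 * (univ.filter fun a : A =>
      let L := blockRating (Function.update σ x a) τ ξ
      ((E.pair k L).1 = x ∧ τ (E.pair k L).2 ∉ E.cols τ L x k ∧ (E.cols τ L x k).card < s) ∧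
        L (E.pair k L).1 (E.pair k L).2 = false).card := by
  classical
  let L : A → X → Y → Bool := fun a => blockRating (Function.update σ x a) τ ξ
  let Q : A → Prop := fun a =>
    (E.pair k (L a)).1 = x ∧ τ (E.pair k (L a)).2 ∉ E.cols τ (L a) x k ∧
      (E.cols τ (L a) x k).card < s
  let D : A → Prop := fun a => L a (E.pair k (L a)).1 (E.pair k (L a)).2 = false
  change (univ.filter Q).card ≤ 8 * (univ.filter fun a => Q a ∧ D a).card
  let J : A → Finset B := fun a => E.cols τ (L a) x k
  -- The types agreeing with `a` on every column label seen in row `x`; they produce the same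
  -- history.
  let C : A → Finset A := fun a => univ.filter fun a' => ∀ j ∈ J a, ξ a' j = ξ a j
  have key : ∀ a a', a' ∈ C a → E.pair k (L a) = E.pair k (L a') ∧ J a = J a' := by
    intro a a' ha
    have ha' := (mem_filter.1 ha).2
    have hag : ∀ p ∈ E.visited (L a) k, L a p.1 p.2 = L a' p.1 p.2 := by
      intro p hp
      by_cases hx : p.1 = x
      · have hj : τ p.2 ∈ J a := mem_image_of_mem (fun p : X × Y => τ p.2) (mem_filter.2 ⟨hp, hx⟩)
        simp [L, blockRating, hx, ha' _ hj]
      · simp [L, blockRating, Function.update_of_ne hx]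
    refine ⟨E.pair_congr hag le_rfl, ?_⟩
    simp only [J, cols]
    rw [E.visited_congr hag]
  have hself : ∀ a, a ∈ C a := fun a => mem_filter.2 ⟨mem_univ _, fun _ _ => rfl⟩
  have hC : ∀ a a', C a' = C a ↔ a' ∈ C a := by
    intro a a'
    refine ⟨fun h => h ▸ hself a', fun h => ?_⟩
    have hJ := (key a a' h).2
    have h' := (mem_filter.1 h).2
    ext a''
    simp only [C, mem_filter, mem_univ, true_and, ← hJ]
    exact forall₂_congr fun j hj => by rw [h' j hj]
  have hQ : ∀ a a', a' ∈ C a → Q a → Q a' := by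
    intro a a' h hq
    have hk := key a a' h
    have hk2 : E.cols τ (L a) x k = E.cols τ (L a') x k := hk.2
    simp only [Q] at hq ⊢
    rwa [← hk.1, ← hk2]
  rw [← filter_filter Q D, card_eq_sum_card_fiberwise (s := univ.filter Q)
      (f := C) (t := (univ.filter Q).image C) fun a ha => mem_image_of_mem C ha,
    card_eq_sum_card_fiberwise (s := (univ.filter Q).filter D)
      (f := C) (t := (univ.filter Q).image C)
      fun a ha => mem_image_of_mem C (mem_filter.1 ha).1, mul_sum]
  refine sum_le_sum fun c hc => ?_
  obtain ⟨a, ha, rfl⟩ := mem_image.1 hc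
  have hqa := (mem_filter.1 ha).2
  set j0 := τ (E.pair k (L a)).2 with hj0
  have hj0J : j0 ∉ J a := hqa.2.1
  have hcard : (J a).card < s := hqa.2.2
  have h1 : ((univ.filter Q).filter fun a' => C a' = C a).card ≤ patternCount ξ (J a) (ξ a) := by
    refine card_le_card fun a' h => ?_
    exact (hC a a').1 (mem_filter.1 h).2
  have h2 : patternCount ξ (insert j0 (J a)) (Function.update (ξ a) j0 false) ≤
      (((univ.filter Q).filter D).filter fun a' => C a' = C a).card := by
    refine card_le_card fun a' h => ?_
    have h' := (mem_filter.1 h).2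
    have hmem : a' ∈ C a := by
      refine mem_filter.2 ⟨mem_univ _, fun j hj => ?_⟩
      have := h' j (mem_insert_of_mem hj)
      rwa [Function.update_of_ne (fun e : j = j0 => hj0J (e ▸ hj))] at this
    have hk := key a a' hmem
    refine mem_filter.2 ⟨mem_filter.2 ⟨mem_filter.2 ⟨mem_univ _, hQ a a' hmem hqa⟩, ?_⟩,
      (hC a a').2 hmem⟩
    have := h' j0 (mem_insert_self _ _)
    simp only [D]
    rw [← hk.1]
    have hx : (E.pair k (L a)).1 = x := hqa.1
    simp only [L, blockRating]
    change ξ (Function.update σ x a' (E.pair k (L a)).1) j0 = false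
    rw [hx]
    simpa using this
  -- With `m` labels seen, a class has at most `2 * |A| / 2 ^ m` members, and at least `|A| / (2 * 2
  -- ^ (m + 1))` of them dislike the new label: hence the factor 8. The strict bound `m < s` leaves
  -- room for the extra column.
  have b1 := (hξ (J a) hcard.le (ξ a)).2
  have b2 := (hξ (insert j0 (J a)) (by rw [card_insert_of_notMem hj0J]; omega)
    (Function.update (ξ a) j0 false)).1
  rw [card_insert_of_notMem hj0J, pow_succ] at b2
  have hpos : 0 < 2 ^ (J a).card := by positivity
  refine Nat.le_of_mul_le_mul_left ?_ hpos
  calc _ ≤ 2 ^ (J a).card * patternCount ξ (J a) (ξ a) := Nat.mul_le_mul_left _ h1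
    _ ≤ 2 * Fintype.card A := b1
    _ ≤ 2 * (2 * (2 ^ (J a).card * 2) *
        patternCount ξ (insert j0 (J a)) (Function.update (ξ a) j0 false)) :=
      Nat.mul_le_mul_left _ b2
    _ = 2 ^ (J a).card * (8 *
        patternCount ξ (insert j0 (J a)) (Function.update (ξ a) j0 false)) := by ring
    _ ≤ _ := Nat.mul_le_mul_left _ (Nat.mul_le_mul_left _ h2)

theorem card_fresh_col_le [Nonempty A] (E : Exploration X Y) (τ : Y → B) (ξ : A → B → Bool) {s : ℕ}
    (hξ : Balanced ξ s) (k : ℕ) :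
    (univ.filter fun σ : X → A =>
      let L := blockRating σ τ ξ
      τ (E.pair k L).2 ∉ E.cols τ L (E.pair k L).1 k ∧
        (E.cols τ L (E.pair k L).1 k).card < s).card ≤
    8 * (univ.filter fun σ : X → A =>
      let L := blockRating σ τ ξ
      L (E.pair k L).1 (E.pair k L).2 = false).card := by
  classical
  let L : (X → A) → X → Y → Bool := fun σ => blockRating σ τ ξ
  let Q : X → (X → A) → Prop := fun x σ => (E.pair k (L σ)).1 = x ∧
    τ (E.pair k (L σ)).2 ∉ E.cols τ (L σ) x k ∧ (E.cols τ (L σ) x k).card < s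
  let D : (X → A) → Prop := fun σ => L σ (E.pair k (L σ)).1 (E.pair k (L σ)).2 = false
  have hrow : ∀ x, (univ.filter (Q x)).card ≤ 8 * (univ.filter fun σ => Q x σ ∧ D σ).card := by
    intro x
    have h := sum_le_sum fun σ (_ : σ ∈ (univ : Finset (X → A))) =>
      E.card_fresh_col_row_le τ ξ hξ k x σ
    simp only [card_filter] at h
    rw [← mul_sum] at h
    -- Averaging the one-row estimate over the other coordinates of `σ` gives it for uniform `σ`.
    have e1 := sum_sum_update x (fun σ : X → A => if Q x σ then (1 : ℕ) else 0)
    have e2 := sum_sum_update x (fun σ : X → A => if Q x σ ∧ D σ then (1 : ℕ) else 0)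
    have h3 : (Fintype.card A : ℕ) * ∑ σ, (if Q x σ then (1 : ℕ) else 0) ≤
        8 * (Fintype.card A * ∑ σ, (if Q x σ ∧ D σ then (1 : ℕ) else 0)) := by
      rw [Nat.cast_id] at e1 e2
      rw [← e1, ← e2]
      exact h
    rw [card_filter, card_filter]
    refine le_of_mul_le_mul_left (a := Fintype.card A) ?_
      (Fintype.card_pos (α := A))
    rw [mul_left_comm]
    exact h3
  have hf : ∀ (R : (X → A) → Prop) [DecidablePred R], (univ.filter R).card =
      ∑ x, (univ.filter fun σ => (E.pair k (L σ)).1 = x ∧ R σ).card := by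
    intro R _
    rw [card_eq_sum_card_fiberwise (f := fun σ => (E.pair k (L σ)).1) (t := univ)
      fun _ _ => mem_coe.2 (mem_univ _)]
    refine sum_congr rfl fun x _ => ?_
    rw [filter_filter]
    simp only [and_comm]
  rw [hf, hf, mul_sum]
  refine sum_le_sum fun x _ => ?_
  refine le_trans (le_of_eq ?_) ((hrow x).trans (Nat.mul_le_mul_left _ (card_le_card ?_)))
  · congr 1
    refine filter_congr fun σ _ => and_congr_right fun h => ?_
    change _ ∉ E.cols τ (L σ) _ _ ∧ _ ↔ _
    rw [h]
  · intro σ hσ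
    have := (mem_filter.1 hσ).2
    exact mem_filter.2 ⟨mem_univ _, this.1.1, this.2⟩

/-- As long as a row has been inspected in few columns, a new column label is disliked with
probability bounded below. -/
theorem sum_min_card_cols_le [Nonempty A] (E : Exploration X Y) (τ : Y → B) (ξ : A → B → Bool)
    {s : ℕ} (hξ : Balanced ξ s) (n : ℕ) :
    ∑ σ : X → A, ∑ x, min (E.cols τ (blockRating σ τ ξ) x n).card s ≤
      8 * ∑ σ : X → A, E.dislikes (blockRating σ τ ξ) n := by
  simp_rw [sum_min_card_cols, dislikes_eq_sum]
  rw [sum_comm, sum_comm (s := univ) (t := range n), mul_sum]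
  refine sum_le_sum fun k _ => ?_
  rw [← card_filter, ← card_filter]
  exact E.card_fresh_col_le τ ξ hξ k

end FreshColumn

end Exploration

-- Types of newly inspected columns: collisions and multiplicities

namespace Exploration

variable {X Y A B : Type*} [DecidableEq X] [DecidableEq Y] [DecidableEq A] [DecidableEq B]

/-- The columns inspected during the first `k` steps. -/
def items (E : Exploration X Y) (L : X → Y → Bool) (k : ℕ) : Finset Y :=
  (E.visited L k).image Prod.snd

theorem items_succ (E : Exploration X Y) (L : X → Y → Bool) (k : ℕ) :
    E.items L (k + 1) = insert (E.pair k L).2 (E.items L k) := by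
  rw [items, visited_succ, image_insert, items]

theorem items_mono (E : Exploration X Y) (L : X → Y → Bool) {k l : ℕ} (h : k ≤ l) :
    E.items L k ⊆ E.items L l :=
  image_subset_image (E.visited_mono L h)

theorem agree_update (E : Exploration X Y) (σ : X → A) (τ : Y → B) (ξ : A → B → Bool) {k : ℕ}
    {y : Y} (hy : y ∉ E.items (blockRating σ τ ξ) k) (b : B) :
    ∀ p ∈ E.visited (blockRating σ τ ξ) k,
      blockRating σ τ ξ p.1 p.2 = blockRating σ (Function.update τ y b) ξ p.1 p.2 := by
  intro p hp
  have : p.2 ≠ y := by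
    rintro rfl
    exact hy (mem_image_of_mem _ hp)
  simp [blockRating, Function.update_of_ne this]

theorem pair_update (E : Exploration X Y) (σ : X → A) (τ : Y → B) (ξ : A → B → Bool) {k : ℕ}
    {y : Y} (hy : y ∉ E.items (blockRating σ τ ξ) k) (b : B) :
    E.pair k (blockRating σ (Function.update τ y b) ξ) = E.pair k (blockRating σ τ ξ) :=
  (E.pair_congr (E.agree_update σ τ ξ hy b) le_rfl).symm

theorem items_update (E : Exploration X Y) (σ : X → A) (τ : Y → B) (ξ : A → B → Bool) {k : ℕ}
    {y : Y} (hy : y ∉ E.items (blockRating σ τ ξ) k) (b : B) :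
    E.items (blockRating σ (Function.update τ y b) ξ) k = E.items (blockRating σ τ ξ) k := by
  rw [items, items, E.visited_congr (E.agree_update σ τ ξ hy b)]

/-- Before column `y` is inspected nothing depends on `τ y`. Hence, given that `y` is the new column
of step `k`, its label is still uniform; the collision and multiplicity estimates both rest on this.
-/
theorem new_update_iff (E : Exploration X Y) (σ : X → A) (τ : Y → B) (ξ : A → B → Bool) {k : ℕ}
    (y : Y) (b : B) :
    ((E.pair k (blockRating σ (Function.update τ y b) ξ)).2 = y ∧
      y ∉ E.items (blockRating σ (Function.update τ y b) ξ) k) ↔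
    ((E.pair k (blockRating σ τ ξ)).2 = y ∧ y ∉ E.items (blockRating σ τ ξ) k) := by
  constructor
  · rintro ⟨h1, h2⟩
    have e1 := E.pair_update σ _ ξ h2 (τ y)
    have e2 := E.items_update σ _ ξ h2 (τ y)
    simp only [Function.update_idem, Function.update_eq_self] at e1 e2
    rw [e1, e2]
    exact ⟨h1, h2⟩
  · rintro ⟨h1, h2⟩
    rw [E.pair_update σ τ ξ h2, E.items_update σ τ ξ h2]
    exact ⟨h1, h2⟩

/-- At some step among the first `n`, while fewer than `K` columns were known, a new column was
inspected whose label had been seen. -/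
def Collides (E : Exploration X Y) (τ : Y → B) (L : X → Y → Bool) (K n : ℕ) : Prop :=
  ∃ k < n, (E.pair k L).2 ∉ E.items L k ∧ (E.items L k).card < K ∧
    τ (E.pair k L).2 ∈ (E.items L k).image τ

theorem injOn_of_not_collides (E : Exploration X Y) (τ : Y → B) (L : X → Y → Bool) {K n : ℕ}
    (h : ¬ E.Collides τ L K n) {k : ℕ} (hk : k ≤ n) (hK : (E.items L k).card ≤ K) :
    Set.InjOn τ (E.items L k) := by
  induction k with
  | zero => simp [items, visited]
  | succ k ih =>
    have hle := card_le_card (E.items_mono L (Nat.le_succ k))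
    have hi := ih (by omega) (hle.trans hK)
    rw [items_succ] at hK ⊢
    by_cases hm : (E.pair k L).2 ∈ E.items L k
    · rwa [insert_eq_of_mem hm]
    · rw [card_insert_of_notMem hm] at hK
      rw [coe_insert, Set.injOn_insert (by simpa using hm)]
      refine ⟨hi, fun hc => h ⟨k, by omega, hm, by omega, ?_⟩⟩
      rw [← mem_coe, coe_image]
      exact hc

theorem sum_new_card_lt (E : Exploration X Y) (L : X → Y → Bool) (K n : ℕ) :
    ∑ k ∈ range n, (if (E.pair k L).2 ∉ E.items L k ∧ (E.items L k).card < K then 1 else 0) =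
      min (E.items L n).card K := by
  induction n with
  | zero => simp [items, visited]
  | succ n ih =>
    rw [sum_range_succ, ih, items_succ]
    by_cases hm : (E.pair n L).2 ∈ E.items L n
    · simp [hm]
    · rw [card_insert_of_notMem hm]
      by_cases hs : (E.items L n).card < K
      · simp only [hm, hs, not_false_eq_true, and_self, if_true]
        omega
      · simp only [hs, and_false, if_false]
        omega

section Resample

variable [Fintype Y] [Fintype B]

theorem image_update (τ : Y → B) {D : Finset Y} {y : Y} (hy : y ∉ D) (b : B) :
    D.image (Function.update τ y b) = D.image τ :=
  image_congr fun z hz => Function.update_of_ne (fun e : z = y => hy (e ▸ hz)) _ _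

/-- The label of a new column is uniform and fewer than `K` labels are taken, so it collides with
conditional probability at most `K / |B|`. The event is split according to the new column `y`, and
`τ y` is resampled. -/
theorem sum_collision_step_le (E : Exploration X Y) (σ : X → A) (ξ : A → B → Bool) (K k : ℕ) :
    Fintype.card B * ∑ τ : Y → B, (
      if (E.pair k (blockRating σ τ ξ)).2 ∉ E.items (blockRating σ τ ξ) k ∧
        (E.items (blockRating σ τ ξ) k).card < K ∧
        τ (E.pair k (blockRating σ τ ξ)).2 ∈ (E.items (blockRating σ τ ξ) k).image τ
      then 1 else 0) ≤
    K * ∑ τ : Y → B, (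
      if (E.pair k (blockRating σ τ ξ)).2 ∉ E.items (blockRating σ τ ξ) k ∧
        (E.items (blockRating σ τ ξ) k).card < K then 1 else 0) := by
  let L : (Y → B) → X → Y → Bool := fun τ => blockRating σ τ ξ
  let N : Y → (Y → B) → Prop := fun y τ => (E.pair k (L τ)).2 = y ∧ y ∉ E.items (L τ) k
  have hN : ∀ y τ b, N y (Function.update τ y b) ↔ N y τ := fun y τ b =>
    E.new_update_iff σ τ ξ y b
  have hy : ∀ y, Fintype.card B * ∑ τ : Y → B,
      (if N y τ ∧ (E.items (L τ) k).card < K ∧ τ y ∈ (E.items (L τ) k).image τ then 1 else 0) ≤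
      K * ∑ τ : Y → B, if N y τ ∧ (E.items (L τ) k).card < K then 1 else 0 := by
    intro y
    have h := sum_sum_update (R := ℕ) y fun τ : Y → B =>
      if N y τ ∧ (E.items (L τ) k).card < K ∧ τ y ∈ (E.items (L τ) k).image τ then 1 else 0
    rw [Nat.cast_id] at h
    rw [← h, mul_sum]
    refine sum_le_sum fun τ _ => ?_
    simp only [hN]
    by_cases hn : N y τ
    · have hi : ∀ b, E.items (L (Function.update τ y b)) k = E.items (L τ) k := fun b =>
        E.items_update σ τ ξ hn.2 b
      by_cases hK : (E.items (L τ) k).card < K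
      · simp only [hn, hi, hK, true_and, if_true, Function.update_self, image_update τ hn.2]
        rw [← card_filter, mul_one]
        refine le_trans (card_le_card fun b hb => (mem_filter.1 hb).2) (card_image_le.trans hK.le)
      · simp [hi, hK]
    · simp [hn]
  have hs : ∀ (R : (Y → B) → Prop) [DecidablePred R], ∑ τ : Y → B,
      (if (E.pair k (L τ)).2 ∉ E.items (L τ) k ∧ R τ then 1 else 0) =
      ∑ y, ∑ τ : Y → B, if N y τ ∧ R τ then 1 else 0 := by
    intro R _
    rw [sum_comm]
    refine sum_congr rfl fun τ _ => ?_
    rw [sum_eq_single (E.pair k (L τ)).2]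
    · simp [N]
    · intro y _ hne
      simp [N, hne.symm]
    · simp
  rw [hs, hs, mul_sum, mul_sum]
  refine sum_le_sum fun y _ => le_trans (le_of_eq ?_) (hy y)
  congr 1
  refine sum_congr rfl fun τ _ => if_congr (and_congr_right fun h => ?_) rfl rfl
  change _ ∧ τ (E.pair k (L τ)).2 ∈ _ ↔ _
  rw [h.1]

open Classical in
/-- The first `K` columns have different labels with probability at least `1 - K ^ 2 / |B|`. -/
theorem card_collides_le (E : Exploration X Y) (σ : X → A) (ξ : A → B → Bool) (K n : ℕ) :
    Fintype.card B * (univ.filter fun τ : Y → B =>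
      E.Collides τ (blockRating σ τ ξ) K n).card ≤ K ^ 2 * Fintype.card (Y → B) := by
  have h1 : (univ.filter fun τ : Y → B => E.Collides τ (blockRating σ τ ξ) K n).card ≤
      ∑ k ∈ range n, ∑ τ : Y → B, (
        if (E.pair k (blockRating σ τ ξ)).2 ∉ E.items (blockRating σ τ ξ) k ∧
          (E.items (blockRating σ τ ξ) k).card < K ∧
          τ (E.pair k (blockRating σ τ ξ)).2 ∈ (E.items (blockRating σ τ ξ) k).image τ
        then 1 else 0) := by
    rw [sum_comm, card_filter]
    refine sum_le_sum fun τ _ => ?_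
    split_ifs with h
    · obtain ⟨k, hk, hc⟩ := h
      refine le_trans (le_of_eq ?_)
        (single_le_sum (fun _ _ => Nat.zero_le _) (mem_range.2 hk))
      rw [if_pos hc]
    · exact Nat.zero_le _
  calc _ ≤ _ := Nat.mul_le_mul_left _ h1
    _ = ∑ k ∈ range n, _ := mul_sum _ _ _
    _ ≤ ∑ k ∈ range n, _ := sum_le_sum fun k _ => E.sum_collision_step_le σ ξ K k
    _ = K * ∑ τ : Y → B, min (E.items (blockRating σ τ ξ) n).card K := by
      rw [← mul_sum, sum_comm]
      simp_rw [sum_new_card_lt]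
    _ ≤ K * ∑ τ : Y → B, K :=
      Nat.mul_le_mul_left _ (sum_le_sum fun τ _ => min_le_right _ _)
    _ = _ := by
      rw [sum_const, card_univ, smul_eq_mul]
      ring

/-- The number of columns with label `j` inspected during the first `k` steps. -/
def mult (E : Exploration X Y) (τ : Y → B) (L : X → Y → Bool) (j : B) (k : ℕ) : ℕ :=
  ((E.items L k).filter fun y => τ y = j).card

/-- The weight is a martingale. A new column doubles the first factor with probability `1 / q`, a
mean growth of `(q + 1) / q`, which the second factor cancels. This serves as an exponential moment
for a multiplicity built up adaptively. -/
theorem sum_mult_weight [Nonempty B] (E : Exploration X Y) (σ : X → A) (ξ : A → B → Bool) (j : B)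
    (n : ℕ) :
    ∑ τ : Y → B, (2 : ℝ) ^ E.mult τ (blockRating σ τ ξ) j n *
      ((Fintype.card B : ℝ) / (Fintype.card B + 1)) ^ (E.items (blockRating σ τ ξ) n).card =
      Fintype.card (Y → B) := by
  set q := (Fintype.card B : ℝ) with hq
  have hq0 : 0 < q := by
    rw [hq]
    exact_mod_cast Fintype.card_pos
  induction n with
  | zero => simp [mult, items, visited]
  | succ k ih =>
    rw [← ih, ← sub_eq_zero, ← sum_sub_distrib]
    let L : (Y → B) → X → Y → Bool := fun τ => blockRating σ τ ξ
    let N : Y → (Y → B) → Prop := fun y τ => (E.pair k (L τ)).2 = y ∧ y ∉ E.items (L τ) k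
    have hN : ∀ y τ b, N y (Function.update τ y b) ↔ N y τ := fun y τ b =>
      E.new_update_iff σ τ ξ y b
    let W : (Y → B) → ℝ := fun τ => (2 : ℝ) ^ E.mult τ (L τ) j k *
      (q / (q + 1)) ^ (E.items (L τ) k).card
    -- Relative increment of the weight when the new column has label `b`; its mean over `b` is
    -- zero.
    let φ : B → ℝ := fun b => (if b = j then 2 else 1) * (q / (q + 1)) - 1
    have hφ : ∑ b, φ b = 0 := by
      simp only [φ]
      rw [sum_sub_distrib, ← sum_mul]
      have : ∑ b : B, (if b = j then (2 : ℝ) else 1) = q + 1 := by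
        have : ∀ b : B, (if b = j then (2 : ℝ) else 1) = 1 + if b = j then 1 else 0 := by
          intro b
          split_ifs <;> norm_num
        simp_rw [this]
        rw [sum_add_distrib]
        simp [hq]
      rw [this]
      simp only [sum_const, card_univ, nsmul_eq_mul, mul_one]
      field_simp
      simp [hq]
    have hstep : ∀ τ : Y → B, (2 : ℝ) ^ E.mult τ (L τ) j (k + 1) *
        (q / (q + 1)) ^ (E.items (L τ) (k + 1)).card - W τ =
        ∑ y, (if N y τ then W τ * φ (τ y) else 0) := by
      intro τ
      rw [sum_eq_single (E.pair k (L τ)).2]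
      · by_cases hm : (E.pair k (L τ)).2 ∈ E.items (L τ) k
        · simp [N, hm, W, mult, items_succ, insert_eq_of_mem hm]
        · simp only [N, hm, not_false_eq_true, and_self, if_true, W, mult, items_succ,
            card_insert_of_notMem hm, filter_insert, φ]
          by_cases hj : τ (E.pair k (L τ)).2 = j
          · rw [if_pos hj, if_pos hj, card_insert_of_notMem (fun h => hm (mem_filter.1 h).1)]
            ring
          · rw [if_neg hj, if_neg hj]
            ring
      · intro y _ hne
        simp [N, hne.symm]
      · simp
    refine (sum_congr rfl fun τ _ => hstep τ).trans ?_
    rw [sum_comm]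
    refine sum_eq_zero fun y _ => ?_
    have h := sum_sum_update y fun τ : Y → B => if N y τ then W τ * φ (τ y) else 0
    have h0 : ∀ τ : Y → B, ∑ b, (if N y (Function.update τ y b) then
        W (Function.update τ y b) * φ (Function.update τ y b y) else 0) = 0 := by
      intro τ
      simp only [hN]
      by_cases hn : N y τ
      · simp only [hn, if_true, Function.update_self]
        have hW : ∀ b, W (Function.update τ y b) = W τ := by
          intro b
          have hi : E.items (L (Function.update τ y b)) k = E.items (L τ) k :=
            E.items_update σ τ ξ hn.2 b
          simp only [W, mult, hi]
          congr 3
          refine filter_congr fun z hz => ?_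
          rw [Function.update_of_ne fun e : z = y => hn.2 (e ▸ hz)]
        simp_rw [hW]
        rw [← mul_sum, hφ, mul_zero]
      · simp [hn]
    simp only [h0, sum_const_zero] at h
    exact (mul_eq_zero.1 h.symm).resolve_left hq0.ne'

open Classical in
/-- No column label is shared by many of the inspected columns. -/
theorem card_mult_le [Nonempty B] (E : Exploration X Y) (σ : X → A) (ξ : A → B → Bool) (n : ℕ)
    (M : ℝ) :
    8 * ((univ.filter fun τ : Y → B => ((E.items (blockRating σ τ ξ) n).card : ℝ) ≤ M ∧
      ∃ j, 2 * M / Fintype.card B + Real.logb 2 (Fintype.card B) + 3 ≤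
        E.mult τ (blockRating σ τ ξ) j n).card : ℝ) ≤ Fintype.card (Y → B) := by
  set q := (Fintype.card B : ℝ) with hq
  have hq0 : 0 < q := by
    rw [hq]
    exact_mod_cast Fintype.card_pos
  set R := 2 * M / q + Real.logb 2 q + 3 with hR
  let T : B → Finset (Y → B) := fun j => univ.filter fun τ =>
    ((E.items (blockRating σ τ ξ) n).card : ℝ) ≤ M ∧ R ≤ E.mult τ (blockRating σ τ ξ) j n
  have hsub : (univ.filter fun τ : Y → B => ((E.items (blockRating σ τ ξ) n).card : ℝ) ≤ M ∧
      ∃ j, R ≤ E.mult τ (blockRating σ τ ξ) j n) ⊆ univ.biUnion T := by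
    intro τ hτ
    obtain ⟨h1, j, hj⟩ := (mem_filter.1 hτ).2
    exact mem_biUnion.2 ⟨j, mem_univ _, mem_filter.2 ⟨mem_univ _, h1, hj⟩⟩
  have hbase : 1 + 1 / q ≤ (2 : ℝ) ^ (2 / q) := by
    have h1 : (2 : ℝ) ^ (2 / q) = Real.exp (Real.log 2 * (2 / q)) :=
      Real.rpow_def_of_pos two_pos _
    have h2 := Real.add_one_le_exp (Real.log 2 * (2 / q))
    have h3 : 1 / q ≤ Real.log 2 * (2 / q) := by
      rw [← mul_div_assoc]
      have := Real.log_two_gt_d9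
      gcongr
      linarith
    linarith
  have hTj : ∀ j, 8 * q * ((T j).card : ℝ) ≤ Fintype.card (Y → B) := by
    intro j
    rw [← E.sum_mult_weight σ ξ j n, mul_comm, ← nsmul_eq_mul, ← hq]
    refine le_trans ?_ (sum_le_sum_of_subset_of_nonneg (subset_univ (T j))
      fun _ _ _ => by positivity)
    refine card_nsmul_le_sum _ _ _ fun τ hτ => ?_
    obtain ⟨hM, hX⟩ := (mem_filter.1 hτ).2
    set m := (E.items (blockRating σ τ ξ) n).card
    set x := E.mult τ (blockRating σ τ ξ) j n
    have e1 : (q / (q + 1)) ^ m = ((1 + 1 / q) ^ m)⁻¹ := by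
      rw [← inv_pow]
      congr 1
      field_simp
    have e2 : (1 + 1 / q) ^ m ≤ (2 : ℝ) ^ (2 * M / q) := by
      calc _ ≤ ((2 : ℝ) ^ (2 / q)) ^ m := by gcongr
        _ = (2 : ℝ) ^ (2 / q * m) := by rw [Real.rpow_mul two_pos.le, Real.rpow_natCast]
        _ ≤ _ := by
          refine Real.rpow_le_rpow_of_exponent_le one_le_two ?_
          rw [mul_div_right_comm]
          gcongr
    have e3 : (2 : ℝ) ^ R ≤ 2 ^ x := by
      rw [← Real.rpow_natCast]
      exact Real.rpow_le_rpow_of_exponent_le one_le_two hX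
    -- The three parts of `R` pay for the normalising factor of the martingale, the union bound over
    -- the `q` labels, and the target probability `1 / 8`.
    have e4 : (2 : ℝ) ^ R = 2 ^ (2 * M / q) * (8 * q) := by
      rw [hR, Real.rpow_add two_pos, Real.rpow_add two_pos, Real.rpow_logb two_pos (by norm_num) hq0]
      norm_num
      ring
    rw [e1, ← div_eq_mul_inv, le_div_iff₀ (by positivity)]
    calc 8 * q * (1 + 1 / q) ^ m ≤ 8 * q * 2 ^ (2 * M / q) := by gcongr
      _ = 2 ^ R := by rw [e4]; ring
      _ ≤ _ := e3
  have hcard := (card_le_card hsub).trans card_biUnion_le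
  have hcard' : ((univ.filter fun τ : Y → B => ((E.items (blockRating σ τ ξ) n).card : ℝ) ≤ M ∧
      ∃ j, R ≤ E.mult τ (blockRating σ τ ξ) j n).card : ℝ) ≤ ∑ j, ((T j).card : ℝ) := by
    exact_mod_cast hcard
  have hsum : q * (8 * ∑ j, ((T j).card : ℝ)) ≤ q * Fintype.card (Y → B) := by
    calc q * (8 * ∑ j, ((T j).card : ℝ)) = ∑ j, 8 * q * ((T j).card : ℝ) := by
          rw [← mul_sum]
          ring
      _ ≤ ∑ _j : B, (Fintype.card (Y → B) : ℝ) := sum_le_sum fun j _ => hTj j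
      _ = _ := by simp [hq]
  have := le_of_mul_le_mul_left hsum hq0
  linarith

end Resample

end Exploration

-- Random matrices are balanced; most user types occur

section Balanced

variable {A B : Type*} [Fintype A] [Fintype B] [DecidableEq A] [DecidableEq B]

theorem two_pow_mul_card_pattern (J : Finset B) (b : B → Bool) :
    2 ^ J.card * (univ.filter fun r : B → Bool => ∀ j ∈ J, r j = b j).card =
      2 ^ Fintype.card B := by
  have h : (univ.filter fun r : B → Bool => ∀ j ∈ J, r j = b j) =
      Fintype.piFinset fun j => if j ∈ J then {b j} else univ := by
    ext r
    simp only [mem_filter, mem_univ, true_and, Fintype.mem_piFinset]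
    refine forall_congr' fun j => ?_
    by_cases hj : j ∈ J <;> simp [hj]
  have h2 : (2 : ℕ) ^ J.card = ∏ j, if j ∈ J then 2 else 1 := by
    rw [prod_ite_mem, univ_inter, prod_const]
  rw [h, Fintype.card_piFinset, h2, ← prod_mul_distrib]
  have : ∀ j, (if j ∈ J then 2 else 1) * (if j ∈ J then {b j} else univ : Finset Bool).card = 2 := by
    intro j
    by_cases hj : j ∈ J <;> simp [hj]
  rw [prod_congr rfl fun j _ => this j]
  simp

/-- The rows are independent and each matches the pattern with probability `2 ^ (-|J|)`: this is the
generating function of a binomial variable. -/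
theorem sum_pow_patternCount (J : Finset B) (b : B → Bool) (t : ℝ) :
    ∑ ξ : A → B → Bool, t ^ patternCount ξ J b =
      Fintype.card (A → B → Bool) * (1 + (t - 1) / 2 ^ J.card) ^ Fintype.card A := by
  have h1 : ∀ ξ : A → B → Bool, t ^ patternCount ξ J b =
      ∏ a, if ∀ j ∈ J, ξ a j = b j then t else 1 := by
    intro ξ
    rw [patternCount, prod_ite, prod_const, prod_const_one, mul_one]
    congr!
  have h2 : ∑ r : B → Bool, (if ∀ j ∈ J, r j = b j then t else 1) =
      2 ^ Fintype.card B * (1 + (t - 1) / 2 ^ J.card) := by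
    have : ∀ r : B → Bool, (if ∀ j ∈ J, r j = b j then t else 1) =
        1 + (t - 1) * if ∀ j ∈ J, r j = b j then 1 else 0 := by
      intro r
      split_ifs <;> ring
    simp_rw [this]
    rw [sum_add_distrib, ← mul_sum, ← Nat.cast_one, ← Nat.cast_zero, ← Nat.cast_sum]
    have hc := two_pow_mul_card_pattern J b
    rw [card_filter] at hc
    have hc' : (2 : ℝ) ^ J.card * ((∑ r : B → Bool, if ∀ j ∈ J, r j = b j then 1 else 0 : ℕ) : ℝ) =
        2 ^ Fintype.card B := by
      exact_mod_cast hc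
    rw [← hc']
    have h0 : ((∑ _r : B → Bool, 1 : ℕ) : ℝ) = 2 ^ Fintype.card B := by simp
    push_cast at h0 ⊢
    rw [h0]
    push_cast at hc'
    rw [← hc']
    field_simp
  simp_rw [h1]
  have h3 := prod_univ_sum (fun _ : A => (univ : Finset (B → Bool)))
    (fun _ r => if ∀ j ∈ J, r j = b j then t else 1)
  rw [Fintype.piFinset_univ] at h3
  rw [← h3, prod_const, h2, card_univ, mul_pow]
  simp [← pow_mul]

-- Chernoff bounds from the generating function at `t = 2` for the upper tail and `t = 1 / 2` for
-- the lower. With mean `μ` the exponents are `(1 - 2 * log 2) * μ` and `(log 2 - 1) / 2 * μ`, both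
-- below `-(log 2 / 8) * μ`.
open Classical in
theorem card_unbalanced_pattern_le (J : Finset B) (b : B → Bool) :
    ((univ.filter fun ξ : A → B → Bool => ¬ (Fintype.card A ≤ 2 * 2 ^ J.card * patternCount ξ J b ∧
      2 ^ J.card * patternCount ξ J b ≤ 2 * Fintype.card A)).card : ℝ) ≤
    2 * Fintype.card (A → B → Bool) * 2 ^ (-((Fintype.card A : ℝ) / 2 ^ J.card / 8)) := by
  set q := (Fintype.card A : ℝ) with hq
  set n := (Fintype.card (A → B → Bool) : ℝ) with hn
  have hn0 : 0 ≤ n := Nat.cast_nonneg _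
  have hq0 : 0 ≤ q := Nat.cast_nonneg _
  set m := J.card
  set μ := q / 2 ^ m with hμ
  have hμ0 : 0 ≤ μ := by positivity
  have hlog := Real.log_two_gt_d9
  have hlog' := Real.log_two_lt_d9
  have mgf : ∀ t : ℝ, 0 ≤ 1 + (t - 1) / 2 ^ m →
      ∑ ξ : A → B → Bool, t ^ patternCount ξ J b ≤ n * Real.exp ((t - 1) * μ) := by
    intro t ht
    rw [sum_pow_patternCount, ← hn]
    refine mul_le_mul_of_nonneg_left ?_ hn0
    calc _ ≤ (Real.exp ((t - 1) / 2 ^ m)) ^ Fintype.card A := by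
          refine pow_le_pow_left₀ ht ?_ _
          rw [add_comm]
          exact Real.add_one_le_exp _
      _ = _ := by
          rw [← Real.exp_nat_mul]
          congr 1
          rw [hμ, ← hq]
          ring
  have hexp : ∀ y : ℝ, (2 : ℝ) ^ y = Real.exp (Real.log 2 * y) := fun y =>
    Real.rpow_def_of_pos two_pos y
  let U := univ.filter fun ξ : A → B → Bool => 2 * μ ≤ patternCount ξ J b
  have up : (U.card : ℝ) ≤
      n * 2 ^ (-(μ / 8)) := by
    have h1 : (U.card : ℝ) *
        2 ^ (2 * μ) ≤ n * Real.exp ((2 - 1) * μ) := by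
      refine le_trans ?_ (mgf 2 (by norm_num; positivity))
      rw [← nsmul_eq_mul]
      refine le_trans ?_ (sum_le_sum_of_subset_of_nonneg (subset_univ U)
        fun _ _ _ => by positivity)
      refine card_nsmul_le_sum _ _ _ fun ξ hξ => ?_
      rw [← Real.rpow_natCast]
      exact Real.rpow_le_rpow_of_exponent_le one_le_two (mem_filter.1 hξ).2
    rw [← le_div_iff₀ (by positivity)] at h1
    refine h1.trans ?_
    rw [mul_div_assoc]
    refine mul_le_mul_of_nonneg_left ?_ hn0
    rw [hexp, hexp, ← Real.exp_sub]
    refine Real.exp_le_exp.2 ?_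
    nlinarith
  let V := univ.filter fun ξ : A → B → Bool => (patternCount ξ J b : ℝ) ≤ μ / 2
  have lo : (V.card : ℝ) ≤
      n * 2 ^ (-(μ / 8)) := by
    have h1 : (V.card : ℝ) *
        2 ^ (-(μ / 2)) ≤ n * Real.exp ((1 / 2 - 1) * μ) := by
      have hm : (1 : ℝ) ≤ 2 ^ m := one_le_pow₀ one_le_two
      refine le_trans ?_ (mgf (1 / 2) ?_)
      · rw [← nsmul_eq_mul]
        refine le_trans ?_ (sum_le_sum_of_subset_of_nonneg (subset_univ V)
          fun _ _ _ => by positivity)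
        refine card_nsmul_le_sum _ _ _ fun ξ hξ => ?_
        rw [one_div, inv_pow, ← Real.rpow_natCast, ← Real.rpow_neg two_pos.le]
        exact Real.rpow_le_rpow_of_exponent_le one_le_two (neg_le_neg (mem_filter.1 hξ).2)
      · have : (1 / 2 - 1 : ℝ) / 2 ^ m = -(1 / 2 / 2 ^ m) := by ring
        rw [this, ← sub_eq_add_neg, sub_nonneg, div_le_one (by positivity)]
        linarith
    rw [← le_div_iff₀ (by positivity)] at h1
    refine h1.trans ?_
    rw [mul_div_assoc]
    refine mul_le_mul_of_nonneg_left ?_ hn0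
    rw [hexp, hexp, ← Real.exp_sub]
    refine Real.exp_le_exp.2 ?_
    nlinarith
  have hsub : (univ.filter fun ξ : A → B → Bool =>
      ¬ (Fintype.card A ≤ 2 * 2 ^ m * patternCount ξ J b ∧
        2 ^ m * patternCount ξ J b ≤ 2 * Fintype.card A)) ⊆
      U ∪
      V := by
    intro ξ hξ
    have h := (mem_filter.1 hξ).2
    rw [mem_union, mem_filter, mem_filter]
    by_contra! hc
    obtain ⟨h1, h2⟩ := hc
    have h1 := h1 (mem_univ _)
    have h2 := h2 (mem_univ _)
    refine h ⟨?_, ?_⟩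
    · have : q ≤ 2 * 2 ^ m * patternCount ξ J b := by
        rw [hμ, div_div, div_lt_iff₀ (by positivity)] at h2
        linarith
      rw [hq] at this
      exact_mod_cast this
    · have : 2 ^ m * patternCount ξ J b ≤ 2 * q := by
        rw [hμ, ← mul_div_assoc, lt_div_iff₀ (by positivity)] at h1
        linarith
      rw [hq] at this
      exact_mod_cast this
  have hc : ((univ.filter fun ξ : A → B → Bool =>
      ¬ (Fintype.card A ≤ 2 * 2 ^ m * patternCount ξ J b ∧
        2 ^ m * patternCount ξ J b ≤ 2 * Fintype.card A)).card : ℝ) ≤ _ :=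
    Nat.cast_le.2 ((card_le_card hsub).trans (card_union_le _ _))
  push_cast at hc
  linarith

open Classical in
/-- A uniformly random matrix is balanced with probability at least `7 / 8`. -/
theorem card_not_balanced_le [Nonempty B] (s : ℕ)
    (h : s * (2 + Real.logb 2 (Fintype.card B)) + 4 ≤ (Fintype.card A : ℝ) / 2 ^ s / 8) :
    8 * (univ.filter fun ξ : A → B → Bool => ¬ Balanced ξ s).card ≤
      Fintype.card (A → B → Bool) := by
  have hb1 : 1 ≤ Fintype.card B := Fintype.card_pos
  set β := Fintype.card B with hβ
  let T : Finset B → (B → Bool) → Finset (A → B → Bool) := fun J b => univ.filter fun ξ =>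
    ¬ (Fintype.card A ≤ 2 * 2 ^ J.card * patternCount ξ J b ∧
      2 ^ J.card * patternCount ξ J b ≤ 2 * Fintype.card A)
  set e := (2 : ℝ) ^ (-((Fintype.card A : ℝ) / 2 ^ s / 8)) with he
  set n := (Fintype.card (A → B → Bool) : ℝ) with hn
  -- Only the restriction of `b` to `J` matters, and it is encoded by the subset `S` of `J` where
  -- `b` is `true`. The union therefore has at most `(s + 1) * (2 * β) ^ s` members.
  have hsub : (univ.filter fun ξ : A → B → Bool => ¬ Balanced ξ s) ⊆
      (range (s + 1)).biUnion fun m => (powersetCard m univ).biUnion fun J =>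
        J.powerset.biUnion fun S => T J fun j => decide (j ∈ S) := by
    intro ξ hξ
    have h := (mem_filter.1 hξ).2
    simp only [Balanced, not_forall] at h
    obtain ⟨J, hJ, b, hb⟩ := h
    refine mem_biUnion.2 ⟨J.card, mem_range.2 (by omega), mem_biUnion.2 ⟨J,
      mem_powersetCard.2 ⟨subset_univ _, rfl⟩, mem_biUnion.2 ⟨J.filter fun j => b j = true,
      mem_powerset.2 (filter_subset _ _), mem_filter.2 ⟨mem_univ _, ?_⟩⟩⟩⟩
    have : patternCount ξ J (fun j => decide (j ∈ J.filter fun j => b j = true)) =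
        patternCount ξ J b := by
      unfold patternCount
      refine congrArg card ?_
      ext a
      simp only [mem_filter, mem_univ, true_and]
      refine forall₂_congr fun j hj => ?_
      simp [hj]
    rw [this]
    exact hb
  have hT : ∀ J : Finset B, J.card ≤ s → ∀ b, ((T J b).card : ℝ) ≤ 2 * n * e := by
    intro J hJ b
    refine (card_unbalanced_pattern_le J b).trans ?_
    refine mul_le_mul_of_nonneg_left ?_ (by positivity)
    refine Real.rpow_le_rpow_of_exponent_le one_le_two (neg_le_neg ?_)
    gcongr
    exact one_le_two
  have hcard : ((univ.filter fun ξ : A → B → Bool => ¬ Balanced ξ s).card : ℝ) ≤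
      ∑ m ∈ range (s + 1), ∑ J ∈ powersetCard m (univ : Finset B), ∑ S ∈ J.powerset,
        ((T J fun j => decide (j ∈ S)).card : ℝ) := by
    have : (univ.filter fun ξ : A → B → Bool => ¬ Balanced ξ s).card ≤
      ∑ m ∈ range (s + 1), ∑ J ∈ powersetCard m (univ : Finset B), ∑ S ∈ J.powerset,
        (T J fun j => decide (j ∈ S)).card :=
      (card_le_card hsub).trans (card_biUnion_le.trans (sum_le_sum fun m _ =>
        card_biUnion_le.trans (sum_le_sum fun J _ => card_biUnion_le)))
    exact_mod_cast this
  have hbound : ∑ m ∈ range (s + 1), ∑ J ∈ powersetCard m (univ : Finset B), ∑ S ∈ J.powerset,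
        ((T J fun j => decide (j ∈ S)).card : ℝ) ≤ (s + 1) * ((2 * β) ^ s * (2 * n * e)) := by
    have hm : ∀ m ∈ range (s + 1), ∑ J ∈ powersetCard m (univ : Finset B), ∑ S ∈ J.powerset,
        ((T J fun j => decide (j ∈ S)).card : ℝ) ≤ (2 * β) ^ s * (2 * n * e) := by
      intro m hm
      have hms : m ≤ s := by
        have := mem_range.1 hm
        omega
      have hJ : ∀ J ∈ powersetCard m (univ : Finset B), ∑ S ∈ J.powerset,
          ((T J fun j => decide (j ∈ S)).card : ℝ) ≤ 2 ^ m * (2 * n * e) := by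
        intro J hJ
        have hJm := (mem_powersetCard.1 hJ).2
        refine (sum_le_sum fun S _ => hT J (hJm.le.trans hms) _).trans (le_of_eq ?_)
        rw [sum_const, card_powerset, hJm, nsmul_eq_mul]
        push_cast
        rfl
      refine (sum_le_sum hJ).trans ?_
      rw [sum_const, card_powersetCard, nsmul_eq_mul, card_univ, ← mul_assoc]
      refine mul_le_mul_of_nonneg_right ?_ (by positivity)
      have h1 : ((β.choose m : ℕ) : ℝ) ≤ (β : ℝ) ^ m := by
        exact_mod_cast Nat.choose_le_pow β m
      have hβ1 : (1 : ℝ) ≤ β := by exact_mod_cast hb1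
      calc ((β.choose m : ℕ) : ℝ) * 2 ^ m ≤ (β : ℝ) ^ m * 2 ^ m := by gcongr
        _ = (2 * β : ℝ) ^ m := by rw [mul_pow, mul_comm]
        _ ≤ _ := pow_le_pow_right₀ (by linarith) hms
    refine (sum_le_sum hm).trans (le_of_eq ?_)
    rw [sum_const, card_range, nsmul_eq_mul]
    push_cast
    rfl
  have hfin : 8 * ((s + 1) * ((2 * β) ^ s * (2 * n * e))) ≤ n := by
    have hβ0 : (0 : ℝ) < β := by exact_mod_cast hb1
    have h1 : ((s : ℝ) + 1) ≤ 2 ^ s := by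
      exact_mod_cast Nat.lt_two_pow_self (n := s)
    have h2 : (2 : ℝ) ^ (s * (2 + Real.logb 2 β) + 4) = 2 ^ s * (2 * β) ^ s * 16 := by
      rw [Real.rpow_add two_pos, mul_comm, mul_comm (s : ℝ), Real.rpow_mul two_pos.le,
        Real.rpow_add two_pos, Real.rpow_logb two_pos (by norm_num) hβ0, Real.rpow_natCast,
        ← mul_pow]
      norm_num
      ring
    have h3 : (2 : ℝ) ^ (s * (2 + Real.logb 2 β) + 4) * e ≤ 1 := by
      rw [he, ← Real.rpow_add two_pos]
      refine Real.rpow_le_one_of_one_le_of_nonpos one_le_two ?_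
      linarith
    rw [h2] at h3
    have hn0 : 0 ≤ n := Nat.cast_nonneg _
    have he0 : 0 ≤ e := by positivity
    calc 8 * (((s : ℝ) + 1) * ((2 * β) ^ s * (2 * n * e)))
        ≤ 8 * (2 ^ s * ((2 * β) ^ s * (2 * n * e))) := by gcongr
      _ = n * (2 ^ s * (2 * β) ^ s * 16 * e) := by ring
      _ ≤ n * 1 := by gcongr
      _ = n := mul_one n
  have : 8 * ((univ.filter fun ξ : A → B → Bool => ¬ Balanced ξ s).card : ℝ) ≤ n := by
    linarith
  rw [hn] at this
  exact_mod_cast this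

end Balanced

/-- At least half of the values are taken with probability at least `7 / 8`. -/
theorem card_image_lt_le {X A : Type*} [Fintype X] [Fintype A] [DecidableEq X] [DecidableEq A]
    [Nonempty A] (h : 4 * Fintype.card A ≤ Fintype.card X) :
    8 * (univ.filter fun σ : X → A => 2 * (univ.image σ).card < Fintype.card A).card ≤
      Fintype.card (X → A) := by
  set q := Fintype.card A with hq
  set N := Fintype.card X with hN
  have hq1 : 1 ≤ q := Fintype.card_pos
  have hmiss : ∀ w : A, (univ.filter fun σ : X → A => w ∉ univ.image σ).card = (q - 1) ^ N := by
    intro w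
    have : (univ.filter fun σ : X → A => w ∉ univ.image σ) =
        Fintype.piFinset fun _ => univ.erase w := by
      ext σ
      simp
    rw [this, Fintype.card_piFinset, prod_const, card_erase_of_mem (mem_univ _)]
    simp [hq, hN]
  have hsum : ∑ σ : X → A, (univ.filter fun w => w ∉ univ.image σ).card = q * (q - 1) ^ N := by
    simp_rw [card_filter]
    rw [sum_comm]
    simp_rw [← card_filter, hmiss]
    simp [hq]
  -- Markov's inequality for the number of missed values.
  have hmarkov : (univ.filter fun σ : X → A => 2 * (univ.image σ).card < q).card * q ≤
      2 * (q * (q - 1) ^ N) := by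
    rw [← hsum, mul_sum, ← smul_eq_mul]
    refine le_trans (card_nsmul_le_sum _ _ _ fun σ hσ => ?_)
      (sum_le_sum_of_subset (subset_univ _))
    have h1 := (mem_filter.1 hσ).2
    have h2 : (univ.filter fun w => w ∉ univ.image σ).card = q - (univ.image σ).card := by
      rw [← card_compl]
      congr 1
      ext
      simp
    omega
  have h16 : 16 * (q - 1) ^ N ≤ q ^ N := by
    have hq0 : (0 : ℝ) < q := by exact_mod_cast hq1
    have hpow : (1 - 1 / (q : ℝ)) ^ N ≤ 1 / 16 := by
      have h0 : 0 ≤ 1 - 1 / (q : ℝ) := by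
        rw [sub_nonneg, div_le_one hq0]
        exact_mod_cast hq1
      calc (1 - 1 / (q : ℝ)) ^ N ≤ Real.exp (-(1 / q)) ^ N := by
            refine pow_le_pow_left₀ h0 ?_ _
            have := Real.add_one_le_exp (-(1 / (q : ℝ)))
            linarith
        _ = Real.exp (-(N / q)) := by
            rw [← Real.exp_nat_mul]
            congr 1
            ring
        _ ≤ Real.exp (-4) := by
            refine Real.exp_le_exp.2 (neg_le_neg ?_)
            rw [le_div_iff₀ hq0]
            exact_mod_cast h
        _ ≤ 1 / 16 := by
            rw [Real.exp_neg, ← one_div]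
            refine one_div_le_one_div_of_le (by norm_num) ?_
            have := Real.exp_one_gt_d9
            calc (16 : ℝ) = 2 ^ 4 := by norm_num
              _ ≤ Real.exp 1 ^ 4 := by gcongr; linarith
              _ = Real.exp 4 := by rw [← Real.exp_nat_mul]; norm_num
    have : 16 * ((q - 1 : ℕ) : ℝ) ^ N ≤ (q : ℝ) ^ N := by
      have e : ((q - 1 : ℕ) : ℝ) = q * (1 - 1 / q) := by
        rw [Nat.cast_sub hq1]
        field_simp
        simp
      rw [e, mul_pow]
      have : 0 < (q : ℝ) ^ N := by positivity
      nlinarith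
    exact_mod_cast this
  have hle : (univ.filter fun σ : X → A => 2 * (univ.image σ).card < q).card ≤ 2 * (q - 1) ^ N := by
    refine Nat.le_of_mul_le_mul_right (c := q) ?_ hq1
    calc _ ≤ _ := hmarkov
      _ = _ := by ring
  rw [Fintype.card_fun, ← hq, ← hN]
  omega

-- Deterministic counts of blocks, labels and items

namespace Exploration

section Counting

variable {X Y A B : Type*} [DecidableEq X] [DecidableEq Y] [DecidableEq A] [DecidableEq B]

/-- The cells inspected in row `x` during the first `k` steps. -/
def row (E : Exploration X Y) (L : X → Y → Bool) (x : X) (k : ℕ) : Finset (X × Y) :=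
  (E.visited L k).filter fun p => p.1 = x

theorem card_row_le (E : Exploration X Y) (τ : Y → B) (L : X → Y → Bool) (x : X) {k r : ℕ}
    (h : ∀ j, E.mult τ L j k ≤ r) : (E.row L x k).card ≤ r * (E.cols τ L x k).card := by
  refine card_le_mul_card_image _ _ fun j _ => le_trans ?_ (h j)
  refine card_le_card_of_injOn Prod.snd ?_ ?_
  · intro p hp
    obtain ⟨h1, h2⟩ := mem_filter.1 hp
    exact mem_coe.2 (mem_filter.2 ⟨mem_image_of_mem _ (mem_filter.1 h1).1, h2⟩)
  · intro p hp p' hp' he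
    have h1 := (mem_filter.1 (mem_filter.1 hp).1).2
    have h2 := (mem_filter.1 (mem_filter.1 hp').1).2
    exact Prod.ext (h1.trans h2.symm) he

theorem mult_le_one (E : Exploration X Y) (τ : Y → B) (L : X → Y → Bool) {k : ℕ}
    (h : Set.InjOn τ (E.items L k)) (j : B) : E.mult τ L j k ≤ 1 := by
  refine card_le_one.2 fun y hy y' hy' => ?_
  obtain ⟨h1, h2⟩ := mem_filter.1 hy
  obtain ⟨h3, h4⟩ := mem_filter.1 hy'
  exact h h1 h3 (h2.trans h4.symm)

/-- One row of each occurring type already contributes `v` blocks, and rows of different types have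
disjoint sets of blocks. -/
theorem mul_card_image_le_card_blocks [Fintype X] (E : Exploration X Y) (σ : X → A) (τ : Y → B)
    (L : X → Y → Bool) (k v : ℕ) (h : ∀ x, v ≤ (E.cols τ L x k).card) :
    v * (univ.image σ).card ≤ (E.blocks σ τ L k).card := by
  refine mul_card_image_le_card_of_maps_to (f := Prod.fst) ?_ v ?_
  · intro e he
    obtain ⟨p, _, rfl⟩ := mem_image.1 he
    exact mem_image_of_mem σ (mem_univ p.1)
  · intro w hw
    obtain ⟨x, _, rfl⟩ := mem_image.1 hw
    refine (h x).trans ?_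
    refine card_le_card_of_injOn (fun j => (σ x, j)) ?_ ?_
    · intro j hj
      obtain ⟨p, hp, rfl⟩ := mem_image.1 hj
      obtain ⟨h1, h2⟩ := mem_filter.1 hp
      subst h2
      exact mem_coe.2 (mem_filter.2 ⟨mem_image_of_mem (Prod.map σ τ) h1, rfl⟩)
    · intro j _ j' _ he
      exact (Prod.ext_iff.1 he).2

theorem exists_card_items_eq (E : Exploration X Y) (L : X → Y → Bool) {K n : ℕ}
    (h : K ≤ (E.items L n).card) : ∃ k ≤ n, (E.items L k).card = K := by
  induction n with
  | zero =>
    refine ⟨0, le_rfl, ?_⟩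
    simp only [items, visited, range_zero, image_empty, card_empty] at h ⊢
    omega
  | succ n ih =>
    by_cases hK : K ≤ (E.items L n).card
    · obtain ⟨k, hk, he⟩ := ih hK
      exact ⟨k, hk.trans (Nat.le_succ n), he⟩
    · refine ⟨n + 1, le_rfl, le_antisymm ?_ h⟩
      rw [items_succ]
      have := card_insert_le (E.pair n L).2 (E.items L n)
      omega

theorem card_le_card_blocks (E : Exploration X Y) (σ : X → A) (τ : Y → B) (L : X → Y → Bool)
    {k n : ℕ} (hk : k ≤ n) (h : Set.InjOn τ (E.items L k)) :
    (E.items L k).card ≤ (E.blocks σ τ L n).card := by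
  rw [← card_image_of_injOn h]
  refine (card_le_card ?_).trans (card_image_le (s := E.blocks σ τ L n) (f := Prod.snd))
  intro j hj
  obtain ⟨y, hy, rfl⟩ := mem_image.1 hj
  obtain ⟨p, hp, rfl⟩ := mem_image.1 hy
  exact mem_image.2 ⟨Prod.map σ τ p, mem_image_of_mem _ (E.visited_mono L hk hp), rfl⟩

/-- With `id` as column labelling, every item is its own type and blocks are pairs of a user type
and an item; grouping them by item gives the counts that the transposed exploration controls. -/
theorem card_blocks_id_le [Fintype Y] (E : Exploration X Y) (σ : X → A) (L : X → Y → Bool)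
    (n : ℕ) :
    (E.blocks σ id L n).card ≤ ∑ y, (E.swap.cols σ (fun y x => L x y) y n).card := by
  rw [card_eq_sum_card_fiberwise (f := Prod.snd) (t := univ) fun _ _ => mem_coe.2 (mem_univ _)]
  refine sum_le_sum fun y _ => ?_
  refine card_le_card_of_injOn Prod.fst ?_ ?_
  · intro e he
    obtain ⟨h1, h2⟩ := mem_filter.1 he
    obtain ⟨p, hp, rfl⟩ := mem_image.1 h1
    refine mem_coe.2 (mem_image.2 ⟨p.swap, mem_filter.2 ⟨?_, h2⟩, rfl⟩)
    rw [swap_visited]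
    exact mem_image_of_mem _ hp
  · intro e he e' he' h
    exact Prod.ext h ((mem_filter.1 he).2.trans (mem_filter.1 he').2.symm)

theorem card_items_le_sum_min [Fintype Y] (E : Exploration X Y) (σ : X → A) (L : X → Y → Bool)
    (n : ℕ) :
    (E.items L n).card ≤ ∑ y, min (E.swap.cols σ (fun y x => L x y) y n).card 1 := by
  have h : ∀ y ∈ E.items L n, 1 ≤ min (E.swap.cols σ (fun y x => L x y) y n).card 1 := by
    intro y hy
    obtain ⟨p, hp, rfl⟩ := mem_image.1 hy
    refine le_min (card_pos.2 ⟨σ p.1, mem_image.2 ⟨p.swap, mem_filter.2 ⟨?_, rfl⟩, rfl⟩⟩) le_rfl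
    rw [swap_visited]
    exact mem_image_of_mem _ hp
  calc (E.items L n).card = ∑ y ∈ E.items L n, 1 := card_eq_sum_ones _
    _ ≤ ∑ y ∈ E.items L n, _ := sum_le_sum h
    _ ≤ _ := sum_le_sum_of_subset (subset_univ _)

end Counting

/-- The rows are served periodically, and the first period does not depend on any observation. -/
structure RoundRobin {N : ℕ} {Y : Type*} (E : Exploration (Fin N) Y) : Prop where
  fst_pair : ∀ k L, ((E.pair k L).1 : ℕ) = k % N
  pair_first : ∀ k < N, ∀ L L', E.pair k L = E.pair k L'

section Rounds

variable {N : ℕ} {Y A B : Type*} [DecidableEq Y] [DecidableEq A] [DecidableEq B]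

theorem le_card_row {E : Exploration (Fin N) Y} (hE : E.RoundRobin) {L : Fin N → Y → Bool} {T : ℕ}
    (hL : Set.InjOn (fun k => E.pair k L) (range (T * N))) (x : Fin N) :
    T ≤ (E.row L x (T * N)).card := by
  have hlt : ∀ t < T, t * N + x < T * N := fun t ht => by
    have := x.2
    have := Nat.mul_le_mul_right N (Nat.succ_le_of_lt ht)
    rw [Nat.succ_mul] at this
    omega
  calc T = (range T).card := (card_range T).symm
    _ ≤ _ := by
      refine card_le_card_of_injOn (fun t => E.pair (t * N + x) L) ?_ ?_
      · intro t ht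
        have ht' := hlt t (mem_range.1 ht)
        refine mem_coe.2 (mem_filter.2 ⟨E.pair_mem_visited L ht', Fin.ext ?_⟩)
        rw [hE.fst_pair, Nat.mul_add_mod_of_lt x.2]
      · intro t ht t' ht' he
        have := hL (mem_coe.2 (mem_range.2 (hlt t (mem_range.1 ht))))
          (mem_coe.2 (mem_range.2 (hlt t' (mem_range.1 ht')))) he
        have hN : 0 < N := x.pos
        exact Nat.eq_of_mul_eq_mul_right hN (by omega)

theorem card_row_le_of_le {E : Exploration (Fin N) Y} (hE : E.RoundRobin) (L : Fin N → Y → Bool)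
    {n s : ℕ} (hn : n ≤ s * N) (x : Fin N) : (E.row L x n).card ≤ s := by
  have h1 : E.row L x n ⊆ ((range n).filter fun k => k % N = x).image fun k => E.pair k L := by
    intro p hp
    obtain ⟨h1, h2⟩ := mem_filter.1 hp
    obtain ⟨k, hk, rfl⟩ := mem_image.1 h1
    refine mem_image_of_mem _ (mem_filter.2 ⟨hk, ?_⟩)
    rw [← hE.fst_pair k L, h2]
  refine (card_le_card h1).trans (card_image_le.trans ?_)
  calc _ ≤ (range s).card := by
        refine card_le_card_of_injOn (fun k => k / N) ?_ ?_
        · intro k hk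
          have := mem_range.1 (mem_filter.1 hk).1
          exact mem_coe.2 (mem_range.2 (Nat.div_lt_of_lt_mul (by rw [mul_comm]; omega)))
        · intro k hk k' hk' he
          have e1 := (mem_filter.1 hk).2
          have e2 := (mem_filter.1 hk').2
          have d1 := Nat.div_add_mod k N
          have d2 := Nat.div_add_mod k' N
          simp only at he
          rw [← d1, ← d2, he, e1, e2]
    _ = s := card_range s

theorem sum_min_cols_eq {E : Exploration (Fin N) Y} (hE : E.RoundRobin) (τ : Y → B)
    {L : Fin N → Y → Bool} {n s : ℕ} (hn : n ≤ s * N)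
    (hL : Set.InjOn (fun k => E.pair k L) (range n)) (hτ : Set.InjOn τ (E.items L n)) :
    n ≤ ∑ x, min (E.cols τ L x n).card s := by
  have hrow : ∀ x, (E.row L x n).card ≤ min (E.cols τ L x n).card s := by
    intro x
    refine le_min ?_ (card_row_le_of_le hE L hn x)
    have := E.card_row_le τ L x (E.mult_le_one τ L hτ)
    rwa [one_mul] at this
  refine le_trans (le_of_eq ?_) (sum_le_sum fun x _ => hrow x)
  calc n = (E.visited L n).card := by rw [visited, card_image_of_injOn hL, card_range]
    _ = _ := card_eq_sum_card_fiberwise (f := Prod.fst) fun _ _ => mem_coe.2 (mem_univ _)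

end Rounds

end Exploration

/-- User types, item types and preference matrix, for finite index sets. -/
abbrev Config (X Y A B : Type*) : Type _ := (X → A) × (Y → B) × (A → B → Bool)

/-- The ratings of a configuration. -/
abbrev Config.rating {X Y A B : Type*} (ω : Config X Y A B) : X → Y → Bool :=
  blockRating ω.1 ω.2.1 ω.2.2

-- Averaging over configurations

section Average

variable {X Y A B : Type*} [Fintype X] [Fintype Y] [Fintype A] [Fintype B]
  [DecidableEq X] [DecidableEq Y] [DecidableEq A] [DecidableEq B]

theorem sum_config (f : Config X Y A B → ℕ) : ∑ ω, f ω = ∑ σ, ∑ τ, ∑ ξ, f (σ, τ, ξ) := by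
  simp_rw [Fintype.sum_prod_type]

theorem card_filter_userType (p : Config X Y A B → Prop) [DecidablePred p] (c : ℕ)
    (h : ∀ τ ξ, c * (univ.filter fun σ => p (σ, τ, ξ)).card ≤ Fintype.card (X → A)) :
    c * (univ.filter p).card ≤ Fintype.card (Config X Y A B) := by
  have e : (univ.filter p).card = ∑ τ, ∑ ξ, (univ.filter fun σ => p (σ, τ, ξ)).card := by
    simp_rw [card_filter]
    rw [sum_config, sum_comm]
    exact sum_congr rfl fun τ _ => sum_comm
  rw [e]
  simp_rw [mul_sum]
  refine (sum_le_sum fun τ _ => sum_le_sum fun ξ _ => h τ ξ).trans (le_of_eq ?_)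
  simp only [sum_const, card_univ, smul_eq_mul, Fintype.card_prod]
  ring

theorem card_filter_itemType (p : Config X Y A B → Prop) [DecidablePred p] (c : ℕ)
    (h : ∀ σ ξ, c * (univ.filter fun τ => p (σ, τ, ξ)).card ≤ Fintype.card (Y → B)) :
    c * (univ.filter p).card ≤ Fintype.card (Config X Y A B) := by
  have e : (univ.filter p).card = ∑ σ, ∑ ξ, (univ.filter fun τ => p (σ, τ, ξ)).card := by
    simp_rw [card_filter]
    rw [sum_config]
    exact sum_congr rfl fun τ _ => sum_comm
  rw [e]
  simp_rw [mul_sum]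
  refine (sum_le_sum fun τ _ => sum_le_sum fun ξ _ => h τ ξ).trans (le_of_eq ?_)
  simp only [sum_const, card_univ, smul_eq_mul, Fintype.card_prod]
  ring

theorem card_filter_pref (p : Config X Y A B → Prop) [DecidablePred p] (c : ℕ)
    (h : ∀ σ τ, c * (univ.filter fun ξ => p (σ, τ, ξ)).card ≤ Fintype.card (A → B → Bool)) :
    c * (univ.filter p).card ≤ Fintype.card (Config X Y A B) := by
  have e : (univ.filter p).card = ∑ σ, ∑ τ, (univ.filter fun ξ => p (σ, τ, ξ)).card := by
    simp_rw [card_filter]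
    rw [sum_config]
  rw [e]
  simp_rw [mul_sum]
  refine (sum_le_sum fun τ _ => sum_le_sum fun ξ _ => h τ ξ).trans (le_of_eq ?_)
  simp only [sum_const, card_univ, smul_eq_mul, Fintype.card_prod]

namespace Exploration

theorem sum_blocks_le (E : Exploration X Y) (n : ℕ) :
    ∑ ω : Config X Y A B, (E.blocks ω.1 ω.2.1 ω.rating n).card ≤
      2 * ∑ ω : Config X Y A B, E.dislikes ω.rating n := by
  rw [sum_config, sum_config]
  simp_rw [mul_sum]
  refine sum_le_sum fun σ _ => sum_le_sum fun τ _ => ?_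
  rw [← mul_sum]
  exact E.sum_card_blocks_le σ τ n

open Classical in
theorem sum_cols_le [Nonempty A] (E : Exploration X Y) (s n : ℕ) :
    ∑ ω : Config X Y A B, (if Balanced ω.2.2 s then
      ∑ x, min (E.cols ω.2.1 ω.rating x n).card s else 0) ≤
      8 * ∑ ω : Config X Y A B, E.dislikes ω.rating n := by
  have e : ∀ f : Config X Y A B → ℕ, ∑ ω, f ω = ∑ τ, ∑ ξ, ∑ σ, f (σ, τ, ξ) := by
    intro f
    rw [sum_config, sum_comm]
    exact sum_congr rfl fun τ _ => sum_comm
  rw [e, e]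
  simp_rw [mul_sum]
  refine sum_le_sum fun τ _ => sum_le_sum fun ξ _ => ?_
  rw [← mul_sum]
  by_cases hξ : Balanced ξ s
  · simp only [hξ, if_true]
    exact E.sum_min_card_cols_le τ ξ hξ n
  · simp [hξ]

open Classical in
theorem sum_rows_le [Nonempty B] (E : Exploration X Y) (s n : ℕ) :
    ∑ ω : Config X Y A B, (if Balanced (fun j w => ω.2.2 w j) s then
      ∑ y, min (E.swap.cols ω.1 (fun y x => ω.rating x y) y n).card s else 0) ≤
      8 * ∑ ω : Config X Y A B, E.dislikes ω.rating n := by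
  have e : ∀ f : Config X Y A B → ℕ, ∑ ω, f ω = ∑ σ, ∑ ξ, ∑ τ, f (σ, τ, ξ) := by
    intro f
    rw [sum_config]
    exact sum_congr rfl fun τ _ => sum_comm
  rw [e, e]
  simp_rw [mul_sum]
  refine sum_le_sum fun σ _ => sum_le_sum fun ξ _ => ?_
  rw [← mul_sum]
  by_cases hξ : Balanced (fun j w => ξ w j) s
  · simp only [hξ, if_true]
    exact E.swap.sum_min_card_cols_le σ (fun j w => ξ w j) hξ n
  · simp [hξ]

end Exploration

open Classical in
/-- The event `p` has probability at most `a / 8` under the uniform distribution. -/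
def Rare {Ω : Type*} [Fintype Ω] (a : ℕ) (p : Ω → Prop) : Prop :=
  8 * (univ.filter p).card ≤ a * Fintype.card Ω

theorem rare_one {Ω : Type*} [Fintype Ω] {p : Ω → Prop} [DecidablePred p]
    (h : 8 * (univ.filter p).card ≤ Fintype.card Ω) : Rare 1 p := by
  rw [Rare, one_mul]
  convert h

theorem Rare.or {Ω : Type*} [Fintype Ω] {p q : Ω → Prop} {a b : ℕ} (hp : Rare a p)
    (hq : Rare b q) : Rare (a + b) fun ω => p ω ∨ q ω := by
  classical
  unfold Rare at *
  have h1 := card_union_le (univ.filter p) (univ.filter q)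
  rw [← filter_or] at h1
  have h2 : 8 * (univ.filter fun ω => p ω ∨ q ω).card ≤ (a + b) * Fintype.card Ω := by
    rw [add_mul]
    refine (Nat.mul_le_mul_left 8 h1).trans ?_
    rw [mul_add]
    exact add_le_add (by convert hp) (by convert hq)
  convert h2

/-- A pointwise bound that holds off a bad event of probability at most one half. -/
theorem Rare.le_sum {Ω : Type*} [Fintype Ω] {bad : Ω → Prop} {a : ℕ} (hbad : Rare a bad)
    (ha : a ≤ 4) (H D : Ω → ℕ) (c : ℕ) {v : ℝ} (hv : 0 ≤ v)
    (hH : ∀ ω, ¬ bad ω → v ≤ H ω) (hsum : ∑ ω, H ω ≤ c * ∑ ω, D ω) :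
    v * Fintype.card Ω ≤ 2 * c * ∑ ω, (D ω : ℝ) := by
  classical
  unfold Rare at hbad
  replace hbad : 8 * (univ.filter bad).card ≤ a * Fintype.card Ω := by convert hbad
  have h1 : ((univ.filter fun ω => ¬ bad ω).card : ℝ) * v ≤ ∑ ω, (H ω : ℝ) := by
    rw [← nsmul_eq_mul]
    refine le_trans (card_nsmul_le_sum _ _ _ fun ω hω => hH ω (mem_filter.1 hω).2) ?_
    exact sum_le_sum_of_subset_of_nonneg (subset_univ _) fun _ _ _ => Nat.cast_nonneg _
  have h2 := card_filter_add_card_filter_not (s := (univ : Finset Ω)) bad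
  rw [card_univ] at h2
  have h3 : (Fintype.card Ω : ℝ) ≤ 2 * (univ.filter fun ω => ¬ bad ω).card := by
    have h5 := Nat.mul_le_mul_right (Fintype.card Ω) ha
    have : Fintype.card Ω ≤ 2 * (univ.filter fun ω => ¬ bad ω).card := by omega
    exact_mod_cast this
  have h4 : ∑ ω, (H ω : ℝ) ≤ c * ∑ ω, (D ω : ℝ) := by exact_mod_cast hsum
  nlinarith

end Average

-- Probabilities of the bad events

section Bounds

open Classical Exploration

variable {N qU qI B T : ℕ} (E : Exploration (Fin N) (Fin B))

local notation "Ω" => Config (Fin N) (Fin B) (Fin qU) (Fin qI)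

theorem card_pref_bad (hqI : 0 < qI) (s : ℕ)
    (h : s * (2 + Real.logb 2 qI) + 4 ≤ (qU : ℝ) / 2 ^ s / 8) :
    Rare 1 fun ω : Ω => ¬ Balanced ω.2.2 s := by
  have : Nonempty (Fin qI) := ⟨⟨0, hqI⟩⟩
  refine rare_one (card_filter_pref _ 8 fun σ τ => ?_)
  exact card_not_balanced_le (A := Fin qU) (B := Fin qI) s (by simpa using h)

theorem card_pref_swap_bad (hqU : 0 < qU) (s : ℕ)
    (h : s * (2 + Real.logb 2 qU) + 4 ≤ (qI : ℝ) / 2 ^ s / 8) :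
    Rare 1 fun ω : Ω => ¬ Balanced (fun j w => ω.2.2 w j) s := by
  have : Nonempty (Fin qU) := ⟨⟨0, hqU⟩⟩
  refine rare_one (card_filter_pref _ 8 fun σ τ => ?_)
  have h := card_not_balanced_le (A := Fin qI) (B := Fin qU) s (by simpa using h)
  have e : (univ.filter fun ξ : Fin qU → Fin qI → Bool =>
      ¬ Balanced (fun j w => ξ w j) s).card =
      (univ.filter fun ξ : Fin qI → Fin qU → Bool => ¬ Balanced ξ s).card := by
    refine card_bij' (fun ξ _ j w => ξ w j) (fun ξ _ w j => ξ j w) ?_ ?_ ?_ ?_ <;> simp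
  simp only at e ⊢
  rw [e]
  refine h.trans (le_of_eq ?_)
  simp [← pow_mul, mul_comm]

theorem card_user_bad (hqU : 0 < qU) (h : 4 * qU ≤ N) :
    Rare 1 fun ω : Ω => 2 * (univ.image ω.1).card < qU := by
  have : Nonempty (Fin qU) := ⟨⟨0, hqU⟩⟩
  refine rare_one (card_filter_userType _ 8 fun τ ξ => ?_)
  have := card_image_lt_le (X := Fin N) (A := Fin qU) (by simpa using h)
  rw [Fintype.card_fin] at this
  convert this

theorem card_collide_bad {K n : ℕ} (hqI : 0 < qI) (hK : 8 * K ^ 2 ≤ qI) :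
    Rare 1 fun ω : Ω => E.Collides ω.2.1 ω.rating K n := by
  refine rare_one (card_filter_itemType _ 8 fun σ ξ => ?_)
  have h := E.card_collides_le (B := Fin qI) σ ξ K n
  rw [Fintype.card_fin] at h
  have h2 := Nat.mul_le_mul_right (Fintype.card (Fin B → Fin qI)) hK
  refine le_of_mul_le_mul_left (a := qI) ?_ hqI
  linarith

theorem card_mult_bad (hqI : 0 < qI) (n : ℕ) (M : ℝ) :
    Rare 1 fun ω : Ω => ((E.items ω.rating n).card : ℝ) ≤ M ∧
      ∃ j, 2 * M / qI + Real.logb 2 qI + 3 ≤ E.mult ω.2.1 ω.rating j n := by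
  have : Nonempty (Fin qI) := ⟨⟨0, hqI⟩⟩
  refine rare_one (card_filter_itemType _ 8 fun σ ξ => ?_)
  have h := E.card_mult_le (B := Fin qI) σ ξ n M
  rw [Fintype.card_fin] at h
  exact_mod_cast h

end Bounds

-- The six terms of the lower bound

section Bounds

open Classical Exploration

variable {N qU qI B T : ℕ} {E : Exploration (Fin N) (Fin B)}

local notation "Ω" => Config (Fin N) (Fin B) (Fin qU) (Fin qI)

/-- Flipping every preference preserves the uniform law and turns each like into a dislike, while
the cells of the first round stay the same. -/
theorem first_round_bound (hE : E.RoundRobin) (hT : 1 ≤ T) :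
    (N : ℝ) * Fintype.card Ω ≤ 2 * ∑ ω : Ω, (E.dislikes ω.rating (T * N) : ℝ) := by
  let F : Ω ≃ Ω := Function.Involutive.toPerm
    (fun ω => (ω.1, ω.2.1, fun w j => !ω.2.2 w j)) (fun ω => by simp)
  have hF : ∀ ω : Ω, E.dislikes ω.rating N + E.dislikes (F ω).rating N = N := by
    intro ω
    rw [dislikes_eq_sum, dislikes_eq_sum, ← sum_add_distrib]
    refine (sum_congr rfl fun k hk => ?_).trans (card_eq_sum_ones (range N)).symm |>.trans
      (card_range N)
    have he := hE.pair_first k (mem_range.1 hk) ω.rating (F ω).rating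
    rw [← he]
    have : (F ω).rating (E.pair k ω.rating).1 (E.pair k ω.rating).2 =
        !ω.rating (E.pair k ω.rating).1 (E.pair k ω.rating).2 := rfl
    rw [this]
    cases ω.rating (E.pair k ω.rating).1 (E.pair k ω.rating).2 <;> simp
  have h1 : N * Fintype.card Ω = 2 * ∑ ω : Ω, E.dislikes ω.rating N := by
    calc N * Fintype.card Ω = ∑ _ω : Ω, N := by simp [mul_comm]
      _ = ∑ ω : Ω, (E.dislikes ω.rating N + E.dislikes (F ω).rating N) :=
        sum_congr rfl fun ω _ => (hF ω).symm
      _ = _ := by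
        rw [sum_add_distrib, Equiv.sum_comp F fun ω : Ω => E.dislikes ω.rating N, two_mul]
  have h2 : N * Fintype.card Ω ≤ 2 * ∑ ω : Ω, E.dislikes ω.rating (T * N) := by
    rw [h1]
    exact Nat.mul_le_mul_left _ (sum_le_sum fun ω _ => E.dislikes_mono _ (Nat.le_mul_of_pos_left N hT))
  exact_mod_cast h2

theorem sq_floor_sqrt_le (q : ℕ) : 8 * ⌊√(q : ℝ) / 3⌋₊ ^ 2 ≤ q := by
  have h := Nat.floor_le (a := √(q : ℝ) / 3) (by positivity)
  have h2 : ((⌊√(q : ℝ) / 3⌋₊ : ℝ)) ^ 2 ≤ (√(q : ℝ) / 3) ^ 2 := by gcongr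
  rw [div_pow, Real.sq_sqrt (Nat.cast_nonneg q)] at h2
  have h3 : (8 : ℝ) * (⌊√(q : ℝ) / 3⌋₊ : ℝ) ^ 2 ≤ q := by
    have : (0 : ℝ) ≤ q := Nat.cast_nonneg q
    linarith
  exact_mod_cast h3

theorem sqrt_le_floor {q : ℕ} (hq : 144 ≤ q) : √(q : ℝ) / 4 ≤ ⌊√(q : ℝ) / 3⌋₊ := by
  have h := Nat.lt_floor_add_one (√(q : ℝ) / 3)
  have h12 : (12 : ℝ) ≤ √(q : ℝ) := by
    refine Real.le_sqrt_of_sq_le ?_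
    have : (144 : ℝ) ≤ q := by exact_mod_cast hq
    linarith
  linarith

theorem card_items_le {X Y : Type*} [DecidableEq X] [DecidableEq Y] (E : Exploration X Y)
    (L : X → Y → Bool) (n : ℕ) : (E.items L n).card ≤ n :=
  card_image_le.trans (card_image_le.trans (card_range n).le)

/-- While at most about `√qI` items are in play, their types are distinct, so every recommendation
brings its user a new item type; during a user's first `s` rounds each costs a constant. -/
theorem user_exploration_bound (hE : E.RoundRobin)
    (hinj : ∀ ω : Ω, Set.InjOn (fun k => E.pair k ω.rating) (range (T * N)))
    (hqU : 0 < qU) (hqI : 144 ≤ qI) (s : ℕ)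
    (hs : s * (2 + Real.logb 2 qI) + 4 ≤ (qU : ℝ) / 2 ^ s / 8) :
    min ((N : ℝ) * T) (min ((N : ℝ) * s) √(qI : ℝ)) / 4 * Fintype.card Ω ≤
      16 * ∑ ω : Ω, (E.dislikes ω.rating (T * N) : ℝ) := by
  have hA : Nonempty (Fin qU) := ⟨⟨0, hqU⟩⟩
  set K := ⌊√(qI : ℝ) / 3⌋₊ with hK
  -- The exploration is stopped early: `n ≤ K` keeps the items few enough to have distinct types,
  -- and `n ≤ s * N` keeps every row below the cap `s`.
  set n := min K (min T s * N) with hn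
  have hnT : n ≤ T * N := (min_le_right _ _).trans (Nat.mul_le_mul_right N (min_le_left _ _))
  have hns : n ≤ s * N := (min_le_right _ _).trans (Nat.mul_le_mul_right N (min_le_right _ _))
  have hbad := (card_pref_bad (N := N) (B := B) (by omega) s hs).or
    (card_collide_bad (N := N) (qU := qU) E (n := n) (by omega) (sq_floor_sqrt_le qI))
  have h := hbad.le_sum (by norm_num) _ _ 8 (v := n) (Nat.cast_nonneg n) ?_
    (E.sum_cols_le (A := Fin qU) (B := Fin qI) s n)
  · have hmono : ∑ ω : Ω, (E.dislikes ω.rating n : ℝ) ≤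
        ∑ ω : Ω, (E.dislikes ω.rating (T * N) : ℝ) :=
      sum_le_sum fun ω _ => Nat.cast_le.2 (E.dislikes_mono _ hnT)
    have hv : min ((N : ℝ) * T) (min ((N : ℝ) * s) √(qI : ℝ)) / 4 ≤ n := by
      have hKr := sqrt_le_floor hqI
      rw [← hK] at hKr
      have h0 : 0 ≤ min ((N : ℝ) * T) (min ((N : ℝ) * s) √(qI : ℝ)) := by positivity
      have h1 := min_le_left ((N : ℝ) * T) (min ((N : ℝ) * s) √(qI : ℝ))
      have h2 := min_le_right ((N : ℝ) * T) (min ((N : ℝ) * s) √(qI : ℝ))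
      have h3 := min_le_left ((N : ℝ) * s) √(qI : ℝ)
      have h4 := min_le_right ((N : ℝ) * s) √(qI : ℝ)
      rw [hn]
      push_cast
      refine le_min (by linarith) ?_
      rcases le_total T s with hTs | hTs
      · rw [min_eq_left (Nat.cast_le.2 hTs)]
        linarith
      · rw [min_eq_right (Nat.cast_le.2 hTs)]
        linarith
    have := mul_le_mul_of_nonneg_right hv (Nat.cast_nonneg (α := ℝ) (Fintype.card Ω))
    simp only [Nat.cast_ofNat] at h
    linarith
  · intro ω hω
    rw [not_or, not_not] at hω
    rw [if_pos hω.1]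
    have hi := E.injOn_of_not_collides ω.2.1 ω.rating hω.2 le_rfl
      ((card_items_le E _ n).trans (min_le_left _ _))
    have := sum_min_cols_eq hE ω.2.1 hns
      ((hinj ω).mono (coe_subset.2 (range_mono hnT))) hi
    exact_mod_cast this

theorem blocks_bound (hE : E.RoundRobin)
    (hinj : ∀ ω : Ω, Set.InjOn (fun k => E.pair k ω.rating) (range (T * N)))
    (hqU : 0 < qU) (hqU' : 4 * qU ≤ N) (hqI : 144 ≤ qI) :
    min ((qU : ℝ) * T) √(qI : ℝ) / 4 * Fintype.card Ω ≤
      4 * ∑ ω : Ω, (E.dislikes ω.rating (T * N) : ℝ) := by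
  set K := ⌊√(qI : ℝ) / 3⌋₊ with hK
  have hbad := (card_user_bad (N := N) (B := B) (qI := qI) hqU hqU').or
    (card_collide_bad (N := N) (qU := qU) E (n := T * N) (by omega) (sq_floor_sqrt_le qI))
  have h := hbad.le_sum (by norm_num) _ _ 2 (v := min ((qU : ℝ) * T) √(qI : ℝ) / 4)
    (by positivity) ?_ (E.sum_blocks_le (A := Fin qU) (B := Fin qI) (T * N))
  · simp only [Nat.cast_ofNat] at h
    linarith
  · intro ω hω
    rw [not_or, not_lt] at hω
    have h0 : 0 ≤ min ((qU : ℝ) * T) √(qI : ℝ) := by positivity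
    have h1 := min_le_left ((qU : ℝ) * T) √(qI : ℝ)
    have h2 := min_le_right ((qU : ℝ) * T) √(qI : ℝ)
    -- With at most `K` items, all of distinct types, each user meets `T` types, giving about `T *
    -- qU / 2` blocks. Otherwise, at the moment of the `K`-th item, there are already `K` types and
    -- so `K` blocks.
    rcases le_total (E.items ω.rating (T * N)).card K with hM | hM
    · have hi := E.injOn_of_not_collides ω.2.1 ω.rating hω.2 le_rfl hM
      have hb := E.mul_card_image_le_card_blocks ω.1 ω.2.1 ω.rating (T * N) T fun x => by
        have := E.card_row_le ω.2.1 ω.rating x (E.mult_le_one ω.2.1 ω.rating hi)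
        rw [one_mul] at this
        exact (le_card_row hE (hinj ω) x).trans this
      have h3 : qU * T ≤ 2 * (E.blocks ω.1 ω.2.1 ω.rating (T * N)).card := by
        calc qU * T ≤ (2 * (univ.image ω.1).card) * T := Nat.mul_le_mul_right _ hω.1
          _ = 2 * (T * (univ.image ω.1).card) := by ring
          _ ≤ _ := Nat.mul_le_mul_left _ hb
      have h4 : (qU : ℝ) * T ≤ 2 * (E.blocks ω.1 ω.2.1 ω.rating (T * N)).card := by
        exact_mod_cast h3
      linarith
    · obtain ⟨k, hk, he⟩ := E.exists_card_items_eq ω.rating hM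
      have hi := E.injOn_of_not_collides ω.2.1 ω.rating hω.2 hk he.le
      have hb := E.card_le_card_blocks ω.1 ω.2.1 ω.rating hk hi
      rw [he] at hb
      have hb' : (K : ℝ) ≤ (E.blocks ω.1 ω.2.1 ω.rating (T * N)).card := by exact_mod_cast hb
      have := sqrt_le_floor hqI
      linarith

/-- Each occurring user type meets `T` items, so the pairs of a user type and an item number at
least `T * qU / 2`. An item is seen by at most `qU` types, so capping its count at `s` keeps at
least the fraction `min s qU / qU`. -/
theorem item_exploration_bound (hE : E.RoundRobin)
    (hinj : ∀ ω : Ω, Set.InjOn (fun k => E.pair k ω.rating) (range (T * N)))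
    (hqU : 0 < qU) (hqU' : 4 * qU ≤ N) (hqI : 0 < qI) (s : ℕ)
    (hs : s * (2 + Real.logb 2 qU) + 4 ≤ (qI : ℝ) / 2 ^ s / 8) :
    min ((T : ℝ) * s) ((T : ℝ) * qU) / 2 * Fintype.card Ω ≤
      16 * ∑ ω : Ω, (E.dislikes ω.rating (T * N) : ℝ) := by
  have hB : Nonempty (Fin qI) := ⟨⟨0, hqI⟩⟩
  have hbad := (card_pref_swap_bad (N := N) (B := B) (qI := qI) hqU s hs).or
    (card_user_bad (N := N) (B := B) (qI := qI) hqU hqU')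
  have h := hbad.le_sum (by norm_num) _ _ 8 (v := min ((T : ℝ) * s) ((T : ℝ) * qU) / 2)
    (by positivity) ?_ (E.sum_rows_le (A := Fin qU) (B := Fin qI) s (T * N))
  · simp only [Nat.cast_ofNat] at h
    linarith
  · intro ω hω
    rw [not_or, not_not, not_lt] at hω
    rw [if_pos hω.1]
    set R : Fin B → ℕ := fun y => (E.swap.cols ω.1 (fun y x => ω.rating x y) y (T * N)).card with hR
    have hb := E.mul_card_image_le_card_blocks ω.1 id ω.rating (T * N) T fun x => by
      have := E.card_row_le id ω.rating x (E.mult_le_one id ω.rating (k := T * N)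
        Function.injective_id.injOn)
      rw [one_mul] at this
      exact (le_card_row hE (hinj ω) x).trans this
    have hsum : T * (univ.image ω.1).card ≤ ∑ y, R y :=
      hb.trans (E.card_blocks_id_le ω.1 ω.rating (T * N))
    have hRq : ∀ y, R y * min s qU ≤ qU * min (R y) s := by
      intro y
      have h1 : R y ≤ qU := (card_le_univ _).trans (Fintype.card_fin qU).le
      rcases le_total (R y) s with h2 | h2
      · rw [min_eq_left h2, mul_comm]
        exact Nat.mul_le_mul_right _ (min_le_right _ _)
      · rw [min_eq_right h2]
        exact Nat.mul_le_mul h1 (min_le_left _ _)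
    have hfin : qU * (T * min s qU) ≤ qU * (2 * ∑ y, min (R y) s) := by
      calc qU * (T * min s qU) ≤ (2 * (univ.image ω.1).card) * (T * min s qU) :=
            Nat.mul_le_mul_right _ hω.2
        _ = 2 * ((T * (univ.image ω.1).card) * min s qU) := by ring
        _ ≤ 2 * ((∑ y, R y) * min s qU) := by gcongr
        _ = 2 * ∑ y, R y * min s qU := by rw [sum_mul]
        _ ≤ 2 * ∑ y, qU * min (R y) s := Nat.mul_le_mul_left _ (sum_le_sum fun y _ => hRq y)
        _ = _ := by rw [← mul_sum]; ring
    have h3 : ((T * min s qU : ℕ) : ℝ) ≤ ((2 * ∑ y, min (R y) s : ℕ) : ℝ) :=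
      Nat.cast_le.2 (Nat.le_of_mul_le_mul_left hfin hqU)
    rw [← mul_min_of_nonneg _ _ (Nat.cast_nonneg T)]
    rw [Nat.cast_mul, Nat.cast_min, Nat.cast_mul 2, Nat.cast_ofNat] at h3
    linarith

/-- The number of different item types needed to serve a user, if `M` items are available. -/
theorem le_rate {q M l t G : ℝ} (hq : 0 < q) (hl : 3 ≤ l) (hM : 0 < M) (hG : 0 ≤ G)
    (ht : 0 ≤ t) (hMG : M ^ 2 = t * q * G) :
    min (G * t / l) M / 4 ≤ G * (t / (2 * M / q + l + 3)) := by
  have hMq : 0 < M / q := by positivity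
  have h1 : 2 * M / q + l + 3 ≤ 2 * (M / q) + 2 * l := by
    rw [mul_div_assoc]
    linarith
  have h2 : 0 < 2 * M / q + l + 3 := by positivity
  rw [← mul_div_assoc, le_div_iff₀ h2]
  have h0 : 0 ≤ min (G * t / l) M := by positivity
  refine (mul_le_mul_of_nonneg_left h1 (by positivity)).trans ?_
  have h3 : min (G * t / l) M * l ≤ G * t := by
    rw [← le_div_iff₀ (by linarith)]
    exact min_le_left _ _
  have h4 : min (G * t / l) M * (M / q) ≤ G * t := by
    -- The choice `M ^ 2 = t * q * G` is exactly what makes `M * (M / q)` equal to `G * t`.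
    calc _ ≤ M * (M / q) := mul_le_mul_of_nonneg_right (min_le_right _ _) hMq.le
      _ = M ^ 2 / q := by ring
      _ = G * t := by
        rw [hMG]
        field_simp
  linarith

theorem div_le_card_cols (hE : E.RoundRobin) (ω : Ω)
    (hinj : Set.InjOn (fun k => E.pair k ω.rating) (range (T * N))) {R : ℝ} (hR : 0 < R)
    (h : ∀ j, (E.mult ω.2.1 ω.rating j (T * N) : ℝ) ≤ R) (x : Fin N) :
    (T : ℝ) / R ≤ (E.cols ω.2.1 ω.rating x (T * N)).card := by
  have h1 := (le_card_row hE hinj x).trans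
    (E.card_row_le ω.2.1 ω.rating x (r := ⌊R⌋₊) fun j => Nat.le_floor (h j))
  rw [div_le_iff₀ hR]
  calc (T : ℝ) ≤ ((⌊R⌋₊ * (E.cols ω.2.1 ω.rating x (T * N)).card : ℕ) : ℝ) := Nat.cast_le.2 h1
    _ = (E.cols ω.2.1 ω.rating x (T * N)).card * (⌊R⌋₊ : ℝ) := by push_cast; ring
    _ ≤ _ := by
      gcongr
      exact Nat.floor_le hR.le

/-- The cost of new types per user and the cost of new items are added. With at most `M` items no
type is repeated often, so every user needs many types; with more than `M` items the item cost alone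
suffices. -/
theorem user_repetition_bound (hE : E.RoundRobin)
    (hinj : ∀ ω : Ω, Set.InjOn (fun k => E.pair k ω.rating) (range (T * N)))
    (hT : 1 ≤ T) (hN : 0 < N) (hqU : 0 < qU) (hqI : 8 ≤ qI) (s : ℕ)
    (hs : s * (2 + Real.logb 2 qI) + 4 ≤ (qU : ℝ) / 2 ^ s / 8)
    (hs1 : (1 : ℕ) * (2 + Real.logb 2 qU) + 4 ≤ (qI : ℝ) / 2 ^ 1 / 8) :
    min ((N : ℝ) * T / Real.logb 2 qI) (min √((T : ℝ) * qI * N) ((N : ℝ) * s)) / 4 *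
      Fintype.card Ω ≤ 32 * ∑ ω : Ω, (E.dislikes ω.rating (T * N) : ℝ) := by
  have hA : Nonempty (Fin qU) := ⟨⟨0, hqU⟩⟩
  have hB : Nonempty (Fin qI) := ⟨⟨0, by omega⟩⟩
  set l := Real.logb 2 qI with hl
  set M := √((T : ℝ) * qI * N) with hM
  have hl3 : 3 ≤ l := by
    rw [hl, Real.le_logb_iff_rpow_le one_lt_two (by exact_mod_cast (by omega : 0 < qI))]
    norm_num
    exact_mod_cast hqI
  have hM0 : 0 < M := by
    have : 0 < T * qI * N := by positivity
    exact Real.sqrt_pos.2 (by exact_mod_cast this)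
  have hR0 : 0 < 2 * M / qI + l + 3 := by positivity
  have hbad := ((card_pref_bad (N := N) (B := B) (by omega) s hs).or
    (card_pref_swap_bad (N := N) (B := B) (qI := qI) hqU 1 hs1)).or
    (card_mult_bad (N := N) (qU := qU) (qI := qI) E (by omega) (T * N) M)
  have hsum := add_le_add (E.sum_cols_le (A := Fin qU) (B := Fin qI) s (T * N))
    (E.sum_rows_le (A := Fin qU) (B := Fin qI) 1 (T * N))
  rw [← sum_add_distrib, ← add_mul] at hsum
  have h := hbad.le_sum (by norm_num) _ _ 16
    (v := min ((N : ℝ) * T / l) (min M ((N : ℝ) * s)) / 4) (by positivity) ?_ hsum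
  · simp only [Nat.cast_ofNat] at h
    linarith
  · intro ω hω
    rw [not_or, not_or, not_not, not_not] at hω
    obtain ⟨⟨h1, h2⟩, h3⟩ := hω
    rw [if_pos h1, if_pos h2, Nat.cast_add]
    have hv0 : 0 ≤ min ((N : ℝ) * T / l) (min M ((N : ℝ) * s)) := by positivity
    have hv1 := min_le_left ((N : ℝ) * T / l) (min M ((N : ℝ) * s))
    have hv2 := (min_le_right ((N : ℝ) * T / l) (min M ((N : ℝ) * s))).trans (min_le_left _ _)
    have hv3 := (min_le_right ((N : ℝ) * T / l) (min M ((N : ℝ) * s))).trans (min_le_right _ _)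
    have hitems := E.card_items_le_sum_min ω.1 ω.rating (T * N)
    have hitems' := Nat.cast_le (α := ℝ).2 hitems
    by_cases hc : ((E.items ω.rating (T * N)).card : ℝ) ≤ M
    · have h4 : ∀ j, (E.mult ω.2.1 ω.rating j (T * N) : ℝ) ≤ 2 * M / qI + l + 3 := by
        intro j
        by_contra! hj
        exact h3 ⟨hc, j, hj.le⟩
      have h5 := div_le_card_cols hE ω (hinj ω) hR0 h4
      have h6 : ∀ x ∈ (univ : Finset (Fin N)), min ((T : ℝ) / (2 * M / qI + l + 3)) s ≤
          ((min (E.cols ω.2.1 ω.rating x (T * N)).card s : ℕ) : ℝ) := by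
        intro x _
        rw [Nat.cast_min]
        exact min_le_min_right _ (h5 x)
      have h7 := card_nsmul_le_sum _ _ _ h6
      rw [card_univ, Fintype.card_fin, nsmul_eq_mul, mul_min_of_nonneg _ _ (Nat.cast_nonneg N)]
        at h7
      have h8 := le_rate (q := qI) (M := M) (l := l) (t := T) (G := N)
        (by exact_mod_cast (by omega : 0 < qI)) hl3 hM0 (Nat.cast_nonneg _) (Nat.cast_nonneg _)
        (by rw [hM, Real.sq_sqrt (by positivity)])
      have h9 : min ((N : ℝ) * T / l) (min M ((N : ℝ) * s)) / 4 ≤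
          min ((N : ℝ) * (T / (2 * M / qI + l + 3))) (N * s) := by
        refine le_min (le_trans ?_ h8) (by linarith)
        gcongr
        exact min_le_left _ _
      refine (h9.trans h7).trans ?_
      rw [← Nat.cast_sum]
      exact le_add_of_nonneg_right (Nat.cast_nonneg _)
    · push Not at hc
      have : (0 : ℝ) ≤ ((∑ x, min (E.cols ω.2.1 ω.rating x (T * N)).card s : ℕ) : ℝ) :=
        Nat.cast_nonneg _
      linarith

/-- The same alternative as for users, with blocks in place of types per user: `N` gives way to
`qU`, half of whose types occur, and no cap `s` is needed because fresh blocks are always fair. -/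
theorem block_repetition_bound (hE : E.RoundRobin)
    (hinj : ∀ ω : Ω, Set.InjOn (fun k => E.pair k ω.rating) (range (T * N)))
    (hT : 1 ≤ T) (hqU : 0 < qU) (hqU' : 4 * qU ≤ N) (hqI : 8 ≤ qI)
    (hs1 : (1 : ℕ) * (2 + Real.logb 2 qU) + 4 ≤ (qI : ℝ) / 2 ^ 1 / 8) :
    min ((qU : ℝ) * T / Real.logb 2 qI) √((T : ℝ) * qI * qU) / 8 *
      Fintype.card Ω ≤ 20 * ∑ ω : Ω, (E.dislikes ω.rating (T * N) : ℝ) := by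
  have hB : Nonempty (Fin qI) := ⟨⟨0, by omega⟩⟩
  set l := Real.logb 2 qI with hl
  set M := √((T : ℝ) * qI * qU) with hM
  have hl3 : 3 ≤ l := by
    rw [hl, Real.le_logb_iff_rpow_le one_lt_two (by exact_mod_cast (by omega : 0 < qI))]
    norm_num
    exact_mod_cast hqI
  have hM0 : 0 < M := by
    have : 0 < T * qI * qU := by positivity
    exact Real.sqrt_pos.2 (by exact_mod_cast this)
  have hR0 : 0 < 2 * M / qI + l + 3 := by positivity
  have hbad := ((card_user_bad (N := N) (B := B) (qI := qI) hqU hqU').or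
    (card_pref_swap_bad (N := N) (B := B) (qI := qI) hqU 1 hs1)).or
    (card_mult_bad (N := N) (qU := qU) (qI := qI) E (by omega) (T * N) M)
  have hsum := add_le_add (E.sum_blocks_le (A := Fin qU) (B := Fin qI) (T * N))
    (E.sum_rows_le (A := Fin qU) (B := Fin qI) 1 (T * N))
  rw [← sum_add_distrib, ← add_mul] at hsum
  have h := hbad.le_sum (by norm_num) _ _ 10 (v := min ((qU : ℝ) * T / l) M / 8)
    (by positivity) ?_ hsum
  · simp only [Nat.cast_ofNat] at h
    linarith
  · intro ω hω
    rw [not_or, not_or, not_lt, not_not] at hω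
    obtain ⟨⟨h1, h2⟩, h3⟩ := hω
    rw [if_pos h2, Nat.cast_add]
    have hv0 : 0 ≤ min ((qU : ℝ) * T / l) M := by positivity
    have hv2 := min_le_right ((qU : ℝ) * T / l) M
    have hitems := E.card_items_le_sum_min ω.1 ω.rating (T * N)
    have hitems' := Nat.cast_le (α := ℝ).2 hitems
    by_cases hc : ((E.items ω.rating (T * N)).card : ℝ) ≤ M
    · have h4 : ∀ j, (E.mult ω.2.1 ω.rating j (T * N) : ℝ) ≤ 2 * M / qI + l + 3 := by
        intro j
        by_contra! hj
        exact h3 ⟨hc, j, hj.le⟩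
      have h5 := div_le_card_cols hE ω (hinj ω) hR0 h4
      have h6 := E.mul_card_image_le_card_blocks ω.1 ω.2.1 ω.rating (T * N)
        ⌈(T : ℝ) / (2 * M / qI + l + 3)⌉₊ fun x => Nat.ceil_le.2 (h5 x)
      have h7 : (T : ℝ) / (2 * M / qI + l + 3) * (univ.image ω.1).card ≤
          (E.blocks ω.1 ω.2.1 ω.rating (T * N)).card := by
        refine le_trans ?_ (Nat.cast_le.2 h6)
        rw [Nat.cast_mul]
        exact mul_le_mul_of_nonneg_right (Nat.le_ceil _) (Nat.cast_nonneg _)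
      have h8 := le_rate (q := qI) (M := M) (l := l) (t := T) (G := qU)
        (by exact_mod_cast (by omega : 0 < qI)) hl3 hM0 (Nat.cast_nonneg _) (Nat.cast_nonneg _)
        (by rw [hM, Real.sq_sqrt (by positivity)])
      have h9 : (qU : ℝ) ≤ 2 * (univ.image ω.1).card := by exact_mod_cast h1
      have h10 : (0 : ℝ) ≤ T / (2 * M / qI + l + 3) := by positivity
      have h11 := mul_le_mul_of_nonneg_right h9 h10
      have : (0 : ℝ) ≤ ((∑ y, min (E.swap.cols ω.1 (fun y x => ω.rating x y) y (T * N)).card 1 : ℕ)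
        : ℝ) := Nat.cast_nonneg _
      nlinarith
    · push Not at hc
      have : (0 : ℝ) ≤ ((E.blocks ω.1 ω.2.1 ω.rating (T * N)).card : ℝ) := Nat.cast_nonneg _
      linarith

end Bounds

-- Admissibility of `sU` and `sI`

section Parameters

theorem six_le_logb {N : ℕ} (hN : 100 < N) : 6 ≤ Real.logb 2 N := by
  rw [Real.le_logb_iff_rpow_le one_lt_two (by exact_mod_cast (by omega : 0 < N))]
  norm_num
  exact_mod_cast (by omega : 64 ≤ N)

theorem nine_le_logb {q : ℕ} (hq : 512 ≤ q) : 9 ≤ Real.logb 2 q := by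
  rw [Real.le_logb_iff_rpow_le one_lt_two (by exact_mod_cast (by omega : 0 < q))]
  norm_num
  exact_mod_cast hq

theorem le_of_hundred_logb_le {N q : ℕ} (hN : 100 < N) (hq : 100 * Real.logb 2 N ≤ q) :
    600 ≤ q := by
  have h := six_le_logb hN
  have : (600 : ℝ) ≤ q := by linarith
  exact_mod_cast this

theorem four_mul_le {N qU : ℕ} (hq : 512 ≤ qU) (h : 20 * (qU : ℝ) * (Real.logb 2 qU) ^ 2 < N) :
    4 * qU ≤ N := by
  have h9 := nine_le_logb hq
  have hq0 : (0 : ℝ) ≤ qU := Nat.cast_nonneg _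
  have h1 : (1 : ℝ) ≤ Real.logb 2 qU ^ 2 := one_le_pow₀ (by linarith)
  have h2 : (4 : ℝ) * qU ≤ N := by nlinarith
  exact_mod_cast h2

theorem logb_mono {a b : ℕ} (ha : 0 < a) (h : a ≤ b) : Real.logb 2 a ≤ Real.logb 2 b :=
  Real.logb_le_logb_of_le one_lt_two (by exact_mod_cast ha) (by exact_mod_cast h)

theorem one_mul_logb_add_le {N qU qI : ℕ} (hN : 100 < N) (hqU : 0 < qU) (hqUN : qU ≤ N)
    (hqI : 100 * Real.logb 2 N ≤ qI) :
    (1 : ℕ) * (2 + Real.logb 2 qU) + 4 ≤ (qI : ℝ) / 2 ^ 1 / 8 := by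
  have h1 := logb_mono hqU hqUN
  have h2 := six_le_logb hN
  push_cast
  linarith

theorem sU_mul_logb_add_le {N qU qI : ℕ} (hN : 100 < N) (hqUN : qU ≤ N) (hqU : 512 ≤ qU)
    (hqI : 512 ≤ qI) :
    sU N qU qI * (2 + Real.logb 2 qI) + 4 ≤ (qU : ℝ) / 2 ^ sU N qU qI / 8 := by
  have hlN := six_le_logb hN
  have hlU := nine_le_logb hqU
  have hlI := nine_le_logb hqI
  have hUN := logb_mono (by omega) hqUN
  have hqU' : (512 : ℝ) ≤ qU := by exact_mod_cast hqU
  rcases Nat.eq_zero_or_pos (sU N qU qI) with hs | hs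
  · rw [hs]
    norm_num
    linarith
  · set s := sU N qU qI with hsdef
    set lN := Real.logb 2 N
    set lI := Real.logb 2 qI
    have hfl : (s : ℝ) ≤ Real.logb 2 qU - Real.logb 2 lI - Real.logb 2 lN - 12 := by
      by_contra! hc
      have := Nat.floor_le (a := Real.logb 2 qU - Real.logb 2 lI - Real.logb 2 lN - 12) ?_
      · exact absurd this (not_le.2 hc)
      · by_contra! hneg
        exact hs.ne' (Nat.floor_of_nonpos hneg.le)
    have hlI0 : 0 ≤ Real.logb 2 lI := Real.logb_nonneg one_lt_two (by linarith)
    have hlN0 : 0 ≤ Real.logb 2 lN := Real.logb_nonneg one_lt_two (by linarith)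
    have hslN : (s : ℝ) ≤ lN := by linarith
    -- The subtracted terms of `sU` become the factors `lI`, `lN` and `2 ^ 12`, and `s ≤ lN` bounds
    -- the left side by a multiple of `lI * lN`.
    have hpow : (2 : ℝ) ^ s * (lI * lN * 4096) ≤ qU := by
      have e1 : (2 : ℝ) ^ (s + Real.logb 2 lI + Real.logb 2 lN + 12 : ℝ) =
          2 ^ s * (lI * lN * 4096) := by
        rw [Real.rpow_add two_pos, Real.rpow_add two_pos, Real.rpow_add two_pos,
          Real.rpow_logb two_pos (by norm_num) (by linarith),
          Real.rpow_logb two_pos (by norm_num) (by linarith), Real.rpow_natCast]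
        norm_num
        ring
      rw [← e1, ← Real.le_logb_iff_rpow_le one_lt_two (by linarith)]
      linarith
    have hdiv : lI * lN * 4096 ≤ (qU : ℝ) / 2 ^ s := by
      rw [le_div_iff₀ (by positivity)]
      linarith
    have h1 : (s : ℝ) * (2 + lI) ≤ lN * (2 + lI) := by gcongr
    nlinarith

theorem sI_mul_logb_add_le {N qU qI : ℕ} (hN : 100 < N) (hqUN : qU ≤ N) (hqU : 512 ≤ qU)
    (hqI : 512 ≤ qI) :
    sI N qI * (2 + Real.logb 2 qU) + 4 ≤ (qI : ℝ) / 2 ^ sI N qI / 8 := by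
  have hlN := six_le_logb hN
  have hlU := nine_le_logb hqU
  have hlI := nine_le_logb hqI
  have hUN := logb_mono (by omega) hqUN
  have hqI' : (512 : ℝ) ≤ qI := by exact_mod_cast hqI
  rcases Nat.eq_zero_or_pos (sI N qI) with hs | hs
  · rw [hs]
    norm_num
    linarith
  · set s := sI N qI with hsdef
    set lN := Real.logb 2 N
    set lI := Real.logb 2 qI
    have hfl : (s : ℝ) ≤ (99 / 100 : ℝ) * lI - 4 * Real.logb 2 lN - 12 := by
      by_contra! hc
      have := Nat.floor_le (a := (99 / 100 : ℝ) * lI - 4 * Real.logb 2 lN - 12) ?_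
      · exact absurd this (not_le.2 hc)
      · by_contra! hneg
        exact hs.ne' (Nat.floor_of_nonpos hneg.le)
    have hlN0 : 0 ≤ Real.logb 2 lN := Real.logb_nonneg one_lt_two (by linarith)
    have hslI : (s : ℝ) ≤ lI := by linarith
    -- The gap between `0.99 * log qI` and `log qI` is spent here: `qI ^ (1 / 100)` absorbs the
    -- factor `lI` coming from `s ≤ lI`. The lost constant 200 is recovered from `lN ^ 4 ≥ 216 *
    -- lN`.
    have hroot : lI / 200 ≤ (2 : ℝ) ^ (lI / 100) := by
      rw [Real.rpow_def_of_pos two_pos]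
      have h1 := Real.add_one_le_exp (Real.log 2 * (lI / 100))
      have h2 := Real.log_two_gt_d9
      nlinarith
    have hpow : (2 : ℝ) ^ s * (lI / 200 * lN ^ 4 * 4096) ≤ qI := by
      have e1 : (2 : ℝ) ^ (s + lI / 100 + Real.logb 2 lN * 4 + 12 : ℝ) =
          2 ^ s * (2 ^ (lI / 100) * lN ^ 4 * 4096) := by
        rw [Real.rpow_add two_pos, Real.rpow_add two_pos, Real.rpow_add two_pos,
          Real.rpow_mul two_pos.le,
          Real.rpow_logb two_pos (by norm_num) (by linarith), Real.rpow_natCast]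
        norm_num
        ring
      calc (2 : ℝ) ^ s * (lI / 200 * lN ^ 4 * 4096) ≤ 2 ^ s * (2 ^ (lI / 100) * lN ^ 4 * 4096) := by
            gcongr
        _ ≤ (qI : ℝ) := by
            rw [← e1, ← Real.le_logb_iff_rpow_le one_lt_two (by linarith)]
            linarith
    have hdiv : lI / 200 * lN ^ 4 * 4096 ≤ (qI : ℝ) / 2 ^ s := by
      rw [le_div_iff₀ (by positivity)]
      linarith
    have h1 : (s : ℝ) * (2 + Real.logb 2 qU) ≤ lI * (2 + lN) := by gcongr
    have h2 : lN * 216 ≤ lN ^ 4 := by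
      have : (6 : ℝ) ^ 3 ≤ lN ^ 3 := by gcongr
      nlinarith
    have h3 : lI * (lN * 216) ≤ lI * lN ^ 4 := by gcongr
    nlinarith

end Parameters

open Exploration in
/-- The lower bound for a deterministic exploration of finitely many items. -/
theorem lowerBound_mul_card_le {N qU qI B T : ℕ} {E : Exploration (Fin N) (Fin B)}
    (hN : 100 < N) (hqUN : 20 * (qU : ℝ) * (Real.logb 2 qU) ^ 2 < N)
    (hqU : 100 * Real.logb 2 N ≤ qU) (hqI : 100 * Real.logb 2 N ≤ qI) (hT : 1 ≤ T)
    (hE : E.RoundRobin)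
    (hinj : ∀ ω : Config (Fin N) (Fin B) (Fin qU) (Fin qI),
      Set.InjOn (fun k => E.pair k ω.rating) (range (T * N))) :
    lowerBound N qU qI T * Fintype.card (Config (Fin N) (Fin B) (Fin qU) (Fin qI)) ≤
      160 * ∑ ω : Config (Fin N) (Fin B) (Fin qU) (Fin qI),
        (E.dislikes ω.rating (T * N) : ℝ) := by
  have hU := le_of_hundred_logb_le hN hqU
  have hI := le_of_hundred_logb_le hN hqI
  have h4 := four_mul_le (by omega) hqUN
  have hUN : qU ≤ N := by omega
  have hU0 : 0 < qU := by omega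
  have b1 := first_round_bound (qU := qU) (qI := qI) hE hT
  have b2 := user_exploration_bound hE hinj hU0 (by omega) _
    (sU_mul_logb_add_le hN hUN (by omega) (by omega))
  have b3 := blocks_bound hE hinj hU0 h4 (by omega)
  have b4 := user_repetition_bound hE hinj hT (by omega) hU0 (by omega) _
    (sU_mul_logb_add_le hN hUN (by omega) (by omega)) (one_mul_logb_add_le hN hU0 hUN hqI)
  have b5 := block_repetition_bound hE hinj hT hU0 h4 (by omega) (one_mul_logb_add_le hN hU0 hUN hqI)
  have b6 := item_exploration_bound hE hinj hU0 h4 (by omega) _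
    (sI_mul_logb_add_le hN hUN (by omega) (by omega))
  have hS : 0 ≤ ∑ ω : Config (Fin N) (Fin B) (Fin qU) (Fin qI),
      (E.dislikes ω.rating (T * N) : ℝ) := sum_nonneg fun _ _ => Nat.cast_nonneg _
  have hC : (0 : ℝ) ≤ Fintype.card (Config (Fin N) (Fin B) (Fin qU) (Fin qI)) :=
    Nat.cast_nonneg _
  rw [lowerBound]
  simp only [max_mul_of_nonneg _ _ hC]
  refine max_le ?_ (max_le ?_ (max_le ?_ (max_le ?_ (max_le ?_ ?_)))) <;> linarith

-- Algorithms with fixed seeds as explorations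

section Deterministic

variable {N : ℕ} {Z : Type*} [MeasurableSpace Z] (A : Algorithm N Z)

/-- The item recommended to user `u` in round `t` when the ratings are `L` and the seeds `z`. -/
def Algorithm.item (z : Fin N → ℕ → Z) (L : Fin N → ℕ → Rating) (u : Fin N) (t : ℕ) : ℕ :=
  A.choose u t (A.history L z t) (z u t)

theorem Algorithm.history_succ (L : Fin N → ℕ → Rating) (z : Fin N → ℕ → Z) (t : ℕ) :
    A.history L z (t + 1) = Fin.snoc (α := fun _ => Fin N → ℕ × Rating) (A.history L z t)
      fun u => (A.item z L u t, L u (A.item z L u t)) := rfl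

theorem Algorithm.history_congr (z : Fin N → ℕ → Z) {L L' : Fin N → ℕ → Rating} {t : ℕ}
    (h : ∀ s < t, ∀ u, L u (A.item z L u s) = L' u (A.item z L u s)) :
    A.history L z t = A.history L' z t := by
  induction t with
  | zero => rfl
  | succ t ih =>
    have hh := ih fun s hs u => h s (hs.trans (Nat.lt_succ_self t)) u
    have hi : ∀ u, A.item z L u t = A.item z L' u t := fun u => by
      rw [Algorithm.item, Algorithm.item, hh]
    rw [Algorithm.history_succ, Algorithm.history_succ, ← hh]
    congr 1
    funext u
    rw [← hi, h t (Nat.lt_succ_self t) u]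

theorem Algorithm.item_congr (z : Fin N → ℕ → Z) {L L' : Fin N → ℕ → Rating} {t : ℕ}
    (h : ∀ s < t, ∀ u, L u (A.item z L u s) = L' u (A.item z L u s)) (u : Fin N) :
    A.item z L u t = A.item z L' u t := by
  rw [Algorithm.item, Algorithm.item, A.history_congr z h]

/-- With the seeds fixed, each round branches only over the finitely many vectors of ratings. This
is what permits the passage to finitely many items. -/
theorem Algorithm.finite_range_history (z : Fin N → ℕ → Z) (t : ℕ) :
    (Set.range fun L => A.history L z t).Finite := by
  induction t with
  | zero => exact Set.toFinite _
  | succ t ih =>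
    refine (Set.Finite.image2 (fun (h : History N t) (r : Fin N → Rating) =>
      (Fin.snoc (α := fun _ => Fin N → ℕ × Rating) h
        fun u => (A.choose u t h (z u t), r u) : History N (t + 1))) ih Set.finite_univ).subset ?_
    rintro _ ⟨L, rfl⟩
    exact ⟨A.history L z t, ⟨L, rfl⟩, fun u => L u (A.item z L u t), Set.mem_univ _, rfl⟩

theorem Algorithm.exists_item_lt (z : Fin N → ℕ → Z) (T : ℕ) :
    ∃ B, 0 < B ∧ ∀ L, ∀ u, ∀ t < T, A.item z L u t < B := by
  have h : (⋃ u : Fin N, ⋃ t : Fin T, Set.range fun L => A.item z L u t).Finite := by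
    refine Set.finite_iUnion fun u => Set.finite_iUnion fun t => ?_
    refine ((A.finite_range_history z t).image fun h => A.choose u t h (z u t)).subset ?_
    rintro _ ⟨L, rfl⟩
    exact ⟨_, ⟨L, rfl⟩, rfl⟩
  obtain ⟨b, hb⟩ := h.bddAbove
  refine ⟨b + 1, Nat.succ_pos b, fun L u t ht => Nat.lt_succ_of_le (hb ?_)⟩
  exact Set.mem_iUnion.2 ⟨u, Set.mem_iUnion.2 ⟨⟨t, ht⟩, L, rfl⟩⟩

/-- Extend ratings of the first `B` items to all items. -/
def extendRating {B : ℕ} (L : Fin N → Fin B → Bool) : Fin N → ℕ → Rating :=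
  fun u i => if h : i < B then L u ⟨i, h⟩ else false

theorem extendRating_of_lt {B : ℕ} (L : Fin N → Fin B → Bool) (u : Fin N) {i : ℕ} (h : i < B) :
    extendRating L u i = L u ⟨i, h⟩ := dif_pos h

theorem mul_add_lt {t T u : ℕ} (ht : t < T) (hu : u < N) : t * N + u < T * N := by
  have := Nat.mul_le_mul_right N (Nat.succ_le_of_lt ht)
  rw [Nat.succ_mul] at this
  omega

theorem mul_add_div_eq {t u : ℕ} (hu : u < N) : (t * N + u) / N = t := by
  rw [mul_comm, Nat.mul_add_div (by omega), Nat.div_eq_of_lt hu, add_zero]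

/-- The first `T` rounds of an algorithm with fixed seeds, as a sequential exploration. -/
def Algorithm.exploration (z : Fin N → ℕ → Z) (T B : ℕ) (hN : 0 < N) (hB : 0 < B)
    (h : ∀ L, ∀ u, ∀ t < T, A.item z L u t < B) : Exploration (Fin N) (Fin B) where
  pair k L := (⟨k % N, Nat.mod_lt k hN⟩, if hk : k < T * N then
    ⟨A.item z (extendRating L) ⟨k % N, Nat.mod_lt k hN⟩ (k / N),
      h _ _ _ (Nat.div_lt_of_lt_mul (by rwa [mul_comm]))⟩ else ⟨0, hB⟩)
  causal L L' k hL := by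
    by_cases hk : k < T * N
    · simp only [hk, dif_pos, Prod.mk.injEq, true_and, Fin.mk.injEq]
      refine A.item_congr z (fun s hs u => ?_) _
      -- All steps of earlier rounds precede step `k`, so agreement on the earlier cells determines
      -- the history of the round. The exploration is in fact allowed more information than the
      -- algorithm uses.
      have hs' : s * N + u < k := by
        have h1 := Nat.mul_le_mul_right N (Nat.succ_le_of_lt hs)
        have h2 := Nat.div_mul_le_self k N
        have h3 := u.2
        rw [Nat.succ_mul] at h1
        omega
      have hsT : s * N + u < T * N := hs'.trans hk
      have hl := hL _ hs'
      simp only [hsT, dif_pos] at hl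
      have e1 : (⟨(s * N + u) % N, Nat.mod_lt _ hN⟩ : Fin N) = u :=
        Fin.ext (Nat.mul_add_mod_of_lt u.2)
      simp only [e1, mul_add_div_eq u.2] at hl
      have hlt := h (extendRating L) u s (hs.trans (Nat.div_lt_of_lt_mul (by rwa [mul_comm])))
      rw [extendRating_of_lt _ _ hlt, extendRating_of_lt _ _ hlt]
      exact hl
    · simp [hk]

variable {z : Fin N → ℕ → Z} {T B : ℕ} (hN : 0 < N) (hB : 0 < B)
  (h : ∀ L, ∀ u, ∀ t < T, A.item z L u t < B)

theorem Algorithm.exploration_roundRobin : (A.exploration z T B hN hB h).RoundRobin where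
  fst_pair _ _ := rfl
  pair_first k hk L L' := by
    by_cases hk' : k < T * N
    · simp only [Algorithm.exploration, hk', dif_pos, Prod.mk.injEq, true_and, Fin.mk.injEq]
      refine A.item_congr z (fun s hs => ?_) _
      rw [Nat.div_eq_of_lt hk] at hs
      exact absurd hs (Nat.not_lt_zero s)
    · simp [Algorithm.exploration, hk']

theorem Algorithm.exploration_pair (L : Fin N → Fin B → Bool) {t : ℕ} (ht : t < T) (u : Fin N) :
    (A.exploration z T B hN hB h).pair (t * N + u) L =
      (u, ⟨A.item z (extendRating L) u t, h _ _ _ ht⟩) := by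
  have e1 : (⟨(t * N + u) % N, Nat.mod_lt _ hN⟩ : Fin N) = u :=
    Fin.ext (Nat.mul_add_mod_of_lt u.2)
  simp only [Algorithm.exploration, mul_add_lt ht u.2, dif_pos, e1, mul_add_div_eq u.2]

theorem Algorithm.exploration_injOn (L : Fin N → Fin B → Bool)
    (hL : ∀ u : Fin N, ∀ s t : ℕ, s < t → t < T →
      A.item z (extendRating L) u s ≠ A.item z (extendRating L) u t) :
    Set.InjOn (fun k => (A.exploration z T B hN hB h).pair k L) (range (T * N)) := by
  intro k hk l hl he
  have hk' := mem_range.1 (mem_coe.1 hk)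
  have hl' := mem_range.1 (mem_coe.1 hl)
  have hkT : k / N < T := Nat.div_lt_of_lt_mul (by rwa [mul_comm])
  have hlT : l / N < T := Nat.div_lt_of_lt_mul (by rwa [mul_comm])
  have ek : k / N * N + (⟨k % N, Nat.mod_lt k hN⟩ : Fin N) = k := Nat.div_add_mod' k N
  have el : l / N * N + (⟨l % N, Nat.mod_lt l hN⟩ : Fin N) = l := Nat.div_add_mod' l N
  have he' := he
  simp only at he'
  rw [← ek, ← el, A.exploration_pair hN hB h L hkT, A.exploration_pair hN hB h L hlT] at he'
  have h1 := (Prod.mk.inj he').1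
  have h2 := Fin.mk.inj (Prod.mk.inj he').2
  rw [← h1] at h2
  have hd : k / N = l / N := by
    rcases lt_trichotomy (k / N) (l / N) with hlt | heq | hgt
    · exact absurd h2 (hL _ _ _ hlt hlT)
    · exact heq
    · exact absurd h2.symm (hL _ _ _ hgt hkT)
  have hm : k % N = l % N := congrArg Fin.val h1
  rw [← Nat.div_add_mod' k N, ← Nat.div_add_mod' l N, hd, hm]

theorem sum_range_mul (f : ℕ → ℕ) (T N : ℕ) :
    ∑ k ∈ range (T * N), f k = ∑ t ∈ range T, ∑ u : Fin N, f (t * N + u) := by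
  induction T with
  | zero => simp
  | succ T ih =>
    rw [Nat.succ_mul, sum_range_add, ih, sum_range_succ, Finset.sum_range fun x => f (T * N + x)]

theorem Algorithm.exploration_dislikes (L : Fin N → Fin B → Bool) :
    (A.exploration z T B hN hB h).dislikes L (T * N) = ∑ t ∈ range T, ∑ u : Fin N,
      if extendRating L u (A.item z (extendRating L) u t) = false then 1 else 0 := by
  rw [Exploration.dislikes_eq_sum, sum_range_mul]
  refine sum_congr rfl fun t ht => sum_congr rfl fun u _ => ?_
  have ht' := mem_range.1 ht
  rw [A.exploration_pair hN hB h L ht' u, extendRating_of_lt L u (h _ _ _ ht')]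

end Deterministic

/-- User types, item types and preference matrix. -/
abbrev Latent (N qU qI : ℕ) : Type :=
  (Fin N → Fin qU) × (ℕ → Fin qI) × (Fin qU → Fin qI → Bool)

/-- The ratings determined by the latent variables. -/
def Latent.rating {N qU qI : ℕ} (x : Latent N qU qI) : Fin N → ℕ → Rating :=
  fun u i => x.2.2 (x.1 u) (x.2.1 i)

/-- Forget all but the first `B` item types. -/
def Latent.restrict {N qU qI : ℕ} (B : ℕ) (x : Latent N qU qI) :
    Config (Fin N) (Fin B) (Fin qU) (Fin qI) :=
  (x.1, fun i => x.2.1 i, x.2.2)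

section Deterministic

variable {N qU qI : ℕ} {Z : Type*} [MeasurableSpace Z] (A : Algorithm N Z)

theorem Latent.extendRating_restrict (x : Latent N qU qI) {B : ℕ} (u : Fin N) {i : ℕ} (h : i < B) :
    extendRating (x.restrict B).rating u i = x.rating u i := by
  rw [extendRating_of_lt _ _ h]
  rfl

/-- The default rating `false` of items beyond `B` is never read during the first `T` rounds. -/
theorem Algorithm.item_restrict {z : Fin N → ℕ → Z} {T B : ℕ}
    (h : ∀ L, ∀ u, ∀ t < T, A.item z L u t < B) (x : Latent N qU qI) (u : Fin N) {t : ℕ}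
    (ht : t < T) :
    A.item z (extendRating (x.restrict B).rating) u t = A.item z x.rating u t :=
  A.item_congr z (fun _ hs v => x.extendRating_restrict v (h _ _ _ (hs.trans ht))) u

/-- The number of dislikes in the first `T` rounds. -/
def Algorithm.cost (T : ℕ) (z : Fin N → ℕ → Z) (L : Fin N → ℕ → Rating) : ℝ :=
  ∑ t ∈ range T, ∑ u : Fin N, if L u (A.item z L u t) = false then 1 else 0

theorem Algorithm.cost_eq {z : Fin N → ℕ → Z} {T B : ℕ} (hN : 0 < N) (hB : 0 < B)
    (h : ∀ L, ∀ u, ∀ t < T, A.item z L u t < B) (x : Latent N qU qI) :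
    A.cost T z x.rating =
      (A.exploration z T B hN hB h).dislikes (x.restrict B).rating (T * N) := by
  rw [A.exploration_dislikes hN hB h, Algorithm.cost]
  push_cast
  refine sum_congr rfl fun t ht => sum_congr rfl fun u _ => ?_
  rw [A.item_restrict h x u (mem_range.1 ht), x.extendRating_restrict u (h _ _ _ (mem_range.1 ht))]

end Deterministic

-- Measurability and integrability of the cost

section Measurability

variable {N qU qI : ℕ} {Z : Type*} [MeasurableSpace Z] (A : Algorithm N Z)

theorem measurable_apply_of_countable {α ι β : Type*} [MeasurableSpace α] [MeasurableSpace ι]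
    [MeasurableSpace β] [Countable ι] [MeasurableSingletonClass ι] {f : α → ι → β} {a : α → ι}
    (hf : ∀ i, Measurable fun x => f x i) (ha : Measurable a) : Measurable fun x => f x (a x) :=
  (measurable_from_prod_countable_left (f := fun p : α × ι => f p.1 p.2) hf).comp
    (measurable_id.prodMk ha)

theorem measurable_latent_rating (u : Fin N) (i : ℕ) :
    Measurable fun x : Latent N qU qI => x.rating u i := by
  have h2 : Measurable fun x : Latent N qU qI => x.2.1 i :=
    (measurable_pi_apply i).comp (measurable_fst.comp measurable_snd)
  have h1 : Measurable fun x : Latent N qU qI => x.1 u :=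
    (measurable_pi_apply u).comp measurable_fst
  have h3 : Measurable fun x : Latent N qU qI => x.2.2 := measurable_snd.comp measurable_snd
  exact measurable_apply_of_countable (f := fun (x : Latent N qU qI) j => x.2.2 (x.1 u) j)
    (fun j => measurable_apply_of_countable (f := fun (x : Latent N qU qI) w => x.2.2 w j)
      (fun w => (measurable_pi_apply j).comp ((measurable_pi_apply w).comp h3)) h1) h2

theorem Algorithm.measurable_history (t : ℕ) :
    Measurable fun p : (Fin N → ℕ → Z) × Latent N qU qI => A.history p.2.rating p.1 t := by
  induction t with
  | zero => exact measurable_const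
  | succ t ih =>
    have hitem : ∀ u, Measurable fun p : (Fin N → ℕ → Z) × Latent N qU qI =>
        A.item p.1 p.2.rating u t := fun u =>
      (A.measurable_choose u t).comp (ih.prodMk
        ((measurable_pi_apply t).comp ((measurable_pi_apply u).comp measurable_fst)))
    have hrate : ∀ u, Measurable fun p : (Fin N → ℕ → Z) × Latent N qU qI =>
        p.2.rating u (A.item p.1 p.2.rating u t) := fun u =>
      measurable_apply_of_countable
        (f := fun (p : (Fin N → ℕ → Z) × Latent N qU qI) i => p.2.rating u i)
        (fun i => (measurable_latent_rating u i).comp measurable_snd) (hitem u)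
    refine measurable_pi_lambda _ fun s => ?_
    simp only [Algorithm.history_succ]
    refine Fin.lastCases ?_ (fun s => ?_) s
    · simp only [Fin.snoc_last]
      exact measurable_pi_lambda _ fun u => (hitem u).prodMk (hrate u)
    · simp only [Fin.snoc_castSucc]
      exact (measurable_pi_apply s).comp ih

theorem Algorithm.measurable_item (u : Fin N) (t : ℕ) :
    Measurable fun p : (Fin N → ℕ → Z) × Latent N qU qI => A.item p.1 p.2.rating u t :=
  (A.measurable_choose u t).comp ((A.measurable_history t).prodMk
    ((measurable_pi_apply t).comp ((measurable_pi_apply u).comp measurable_fst)))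

theorem Algorithm.measurable_cost (T : ℕ) :
    Measurable fun p : (Fin N → ℕ → Z) × Latent N qU qI => A.cost T p.1 p.2.rating := by
  refine Finset.measurable_sum _ fun t _ => Finset.measurable_sum _ fun u _ => ?_
  refine Measurable.ite ?_ measurable_const measurable_const
  have : Measurable fun p : (Fin N → ℕ → Z) × Latent N qU qI =>
      p.2.rating u (A.item p.1 p.2.rating u t) :=
    measurable_apply_of_countable
      (f := fun (p : (Fin N → ℕ → Z) × Latent N qU qI) i => p.2.rating u i)
      (fun i => (measurable_latent_rating u i).comp measurable_snd) (A.measurable_item u t)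
  exact this (measurableSet_singleton false)

theorem Algorithm.cost_nonneg (T : ℕ) (z : Fin N → ℕ → Z) (L : Fin N → ℕ → Rating) :
    0 ≤ A.cost T z L :=
  sum_nonneg fun _ _ => sum_nonneg fun _ _ => by split_ifs <;> norm_num

theorem Algorithm.cost_le (T : ℕ) (z : Fin N → ℕ → Z) (L : Fin N → ℕ → Rating) :
    A.cost T z L ≤ T * N := by
  calc A.cost T z L ≤ ∑ t ∈ range T, ∑ u : Fin N, 1 :=
        sum_le_sum fun _ _ => sum_le_sum fun _ _ => by split_ifs <;> norm_num
    _ = T * N := by simp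

theorem Algorithm.integrable_cost (T : ℕ) (μ : Measure ((Fin N → ℕ → Z) × Latent N qU qI))
    [IsFiniteMeasure μ] : Integrable (fun p => A.cost T p.1 p.2.rating) μ := by
  refine Integrable.of_bound (A.measurable_cost T).aestronglyMeasurable (T * N)
    (Filter.Eventually.of_forall fun p => ?_)
  rw [Real.norm_of_nonneg (A.cost_nonneg T _ _)]
  exact A.cost_le T _ _

theorem Latent.measurable_restrict (B : ℕ) :
    Measurable (Latent.restrict B : Latent N qU qI → _) :=
  measurable_fst.prodMk ((measurable_pi_lambda _ fun _ => (measurable_pi_apply _).comp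
    (measurable_fst.comp measurable_snd)).prodMk (measurable_snd.comp measurable_snd))

end Measurability

/-- The sources other than the seeds. -/
def latentSources (N qU qI : ℕ) : Set (Source N qU qI) :=
  {s | ∀ u t, s ≠ .seed u t}

/-- The sources of a finite configuration. -/
def configSource (N qU qI B : ℕ) :
    Fin N ⊕ Fin B ⊕ (Fin qU × Fin qI) → Source N qU qI
  | .inl u => .user u
  | .inr (.inl i) => .item i
  | .inr (.inr e) => .entry e.1 e.2

theorem configSource_injective (N qU qI B : ℕ) :
    Function.Injective (configSource N qU qI B) := by
  rintro (u | i | e) (u' | i' | e') h <;> simp_all [configSource, Fin.ext_iff, Prod.ext_iff]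

-- Joint law of the seeds and the latent variables

namespace Model

variable {N qU qI : ℕ} {Z : Type*} [MeasurableSpace Z] {Ω : Type*} [MeasurableSpace Ω]
  {P : Measure Ω} (M : Model N qU qI Z P)

/-- The latent variables of the model. -/
def latent (ω : Ω) : Latent N qU qI :=
  (fun u => M.userType u ω, fun i => M.itemType i ω, fun w j => M.pref w j ω)

/-- The seeds of the model. -/
def seeds (ω : Ω) : Fin N → ℕ → Z := fun u t => M.seed u t ω

theorem measurable_latent : Measurable M.latent :=
  (measurable_pi_lambda _ M.measurable_userType).prodMk
    ((measurable_pi_lambda _ M.measurable_itemType).prodMk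
      (measurable_pi_lambda _ fun w => measurable_pi_lambda _ (M.measurable_pref w)))

theorem measurable_seeds : Measurable M.seeds :=
  measurable_pi_lambda _ fun u => measurable_pi_lambda _ (M.measurable_seed u)

theorem sourceSigma_le (s : Source N qU qI) :
    sourceSigma M.userType M.itemType M.pref M.seed s ≤ ‹MeasurableSpace Ω› := by
  cases s with
  | user u => exact (M.measurable_userType u).comap_le
  | item i => exact (M.measurable_itemType i).comap_le
  | entry w j => exact (M.measurable_pref w j).comap_le
  | seed u t => exact (M.measurable_seed u t).comap_le

/-- The two are measurable with respect to σ-algebras generated by disjoint groups of the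
independent sources. -/
theorem indepFun_seeds_latent [IsProbabilityMeasure P] : IndepFun M.seeds M.latent P := by
  set m := sourceSigma M.userType M.itemType M.pref M.seed with hm
  have h := indep_iSup_of_disjoint M.sourceSigma_le M.indep
    (S := (latentSources N qU qI)ᶜ) (T := latentSources N qU qI) disjoint_compl_left
  rw [IndepFun_iff_Indep]
  refine indep_of_indep_of_le_left (indep_of_indep_of_le_right h ?_) ?_
  · have hs : ∀ s ∈ latentSources N qU qI, m s ≤ ⨆ i ∈ latentSources N qU qI, m i :=
      fun s hs => le_iSup₂_of_le s hs le_rfl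
    refine Measurable.comap_le ?_
    refine Measurable.prodMk ?_ (Measurable.prodMk ?_ ?_)
    · refine @measurable_pi_lambda _ _ _ (_) _ _ fun u => ?_
      exact (comap_measurable (M.userType u)).mono (hs (.user u) (by simp [latentSources])) le_rfl
    · refine @measurable_pi_lambda _ _ _ (_) _ _ fun i => ?_
      exact (comap_measurable (M.itemType i)).mono (hs (.item i) (by simp [latentSources])) le_rfl
    · refine @measurable_pi_lambda _ _ _ (_) _ _ fun w => ?_
      refine @measurable_pi_lambda _ _ _ (_) _ _ fun j => ?_
      exact (comap_measurable (M.pref w j)).mono (hs (.entry w j) (by simp [latentSources])) le_rfl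
  · have hs : ∀ s ∈ (latentSources N qU qI)ᶜ, m s ≤ ⨆ i ∈ (latentSources N qU qI)ᶜ, m i :=
      fun s hs => le_iSup₂_of_le s hs le_rfl
    refine Measurable.comap_le ?_
    refine @measurable_pi_lambda _ _ _ (_) _ _ fun u => ?_
    refine @measurable_pi_lambda _ _ _ (_) _ _ fun t => ?_
    exact (comap_measurable (M.seed u t)).mono (hs (.seed u t) (by simp [latentSources])) le_rfl

theorem measure_restrict_latent [IsProbabilityMeasure P] (B : ℕ)
    (c : Config (Fin N) (Fin B) (Fin qU) (Fin qI)) :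
    P {ω | (M.latent ω).restrict B = c} =
      (Fintype.card (Config (Fin N) (Fin B) (Fin qU) (Fin qI)) : ℝ≥0∞)⁻¹ := by
  let S : Fin N ⊕ Fin B ⊕ (Fin qU × Fin qI) → Set Ω
    | .inl u => {ω | M.userType u ω = c.1 u}
    | .inr (.inl i) => {ω | M.itemType i ω = c.2.1 i}
    | .inr (.inr e) => {ω | M.pref e.1 e.2 ω = c.2.2 e.1 e.2}
  have hS : {ω | (M.latent ω).restrict B = c} = ⋂ i, S i := by
    ext ω
    simp only [Set.mem_iInter, Sum.forall, Prod.forall, S, Set.mem_ofPred_eq]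
    simp only [Latent.restrict, latent, Prod.ext_iff, funext_iff]
  have hind := (M.indep.precomp (configSource_injective N qU qI B)).meas_iInter (s := S) (by
    rintro (u | i | e)
    · exact ⟨{c.1 u}, measurableSet_singleton _, rfl⟩
    · exact ⟨{c.2.1 i}, measurableSet_singleton _, rfl⟩
    · exact ⟨{c.2.2 e.1 e.2}, measurableSet_singleton _, rfl⟩)
  rw [hS, hind, Fintype.prod_sum_type, Fintype.prod_sum_type]
  simp only [S, M.userType_uniform, M.itemType_uniform, M.pref_uniform, prod_const, card_univ]
  simp only [Fintype.card_prod, Fintype.card_fun, Fintype.card_fin, Fintype.card_bool]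
  push_cast
  have h1 : ∀ (q n : ℕ), (q : ℝ≥0∞) ^ n ≠ ⊤ := fun q n =>
    ENNReal.pow_ne_top (ENNReal.natCast_ne_top q)
  have h2 : ((2 : ℝ≥0∞) ^ qI) ^ qU ≠ ⊤ := ENNReal.pow_ne_top (ENNReal.pow_ne_top (by norm_num))
  rw [ENNReal.mul_inv (Or.inr (ENNReal.mul_ne_top (h1 _ _) h2)) (Or.inl (h1 _ _)),
    ENNReal.mul_inv (Or.inr h2) (Or.inl (h1 _ _)), ← ENNReal.inv_pow, ← ENNReal.inv_pow,
    ← ENNReal.inv_pow, ← pow_mul, mul_comm qI qU]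

end Model

-- From finite averages to the regret

section Main

variable {N qU qI : ℕ} {Z : Type*} [MeasurableSpace Z] {Ω : Type*} [MeasurableSpace Ω]
  {P : Measure Ω} (M : Model N qU qI Z P) (A : Algorithm N Z)

theorem mul_regret_eq (hN : 0 < N) (T : ℕ) :
    (N : ℝ) * regret M A T = ∫ ω, A.cost T (M.seeds ω) (M.latent ω).rating ∂P := by
  rw [regret, ← integral_const_mul]
  refine integral_congr_ae (Filter.Eventually.of_forall fun ω => ?_)
  have hN' : (N : ℝ) ≠ 0 := by exact_mod_cast hN.ne'
  simp only
  rw [← mul_sum, ← mul_assoc, mul_one_div_cancel hN', one_mul]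
  rfl

theorem real_map_restrict [IsProbabilityMeasure P] (B : ℕ) (c : Config (Fin N) (Fin B) (Fin qU) (Fin qI)) :
    ((P.map M.latent).map (Latent.restrict B)).real {c} =
      (Fintype.card (Config (Fin N) (Fin B) (Fin qU) (Fin qI)) : ℝ)⁻¹ := by
  rw [Measure.real, Measure.map_map (Latent.measurable_restrict B) M.measurable_latent,
    Measure.map_apply ((Latent.measurable_restrict B).comp M.measurable_latent)
      (measurableSet_singleton c)]
  have := M.measure_restrict_latent B c
  change (P {ω | (M.latent ω).restrict B = c}).toReal = _
  rw [this, ENNReal.toReal_inv, ENNReal.toReal_natCast]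

/-- Every finite configuration has positive probability, so an almost sure property cannot miss any
of them. Thus almost sure absence of repetitions becomes injectivity for every configuration. -/
theorem exists_restrict_eq [IsProbabilityMeasure P] {p : Latent N qU qI → Prop}
    (hp : ∀ᵐ x ∂(P.map M.latent), p x) (B : ℕ) (c : Config (Fin N) (Fin B) (Fin qU) (Fin qI)) :
    ∃ x : Latent N qU qI, x.restrict B = c ∧ p x := by
  by_contra! hc
  have h0 : P.map M.latent (Latent.restrict B ⁻¹' {c}) = 0 :=
    measure_mono_null (fun x hx => hc x hx) hp
  rw [Measure.map_apply M.measurable_latent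
    (Latent.measurable_restrict B (measurableSet_singleton c))] at h0
  have h1 := M.measure_restrict_latent B c
  change P {ω | (M.latent ω).restrict B = c} = 0 at h0
  rw [h0] at h1
  exact ENNReal.inv_ne_zero.2 (ENNReal.natCast_ne_top _) h1.symm

/-- The lower bound for almost every realization of the seeds. -/
theorem le_integral_cost [IsProbabilityMeasure P] {T : ℕ} (hN : 100 < N)
    (hqUN : 20 * (qU : ℝ) * (Real.logb 2 qU) ^ 2 < N)
    (hqU : 100 * Real.logb 2 N ≤ qU) (hqI : 100 * Real.logb 2 N ≤ qI) (hT : 1 ≤ T)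
    (z : Fin N → ℕ → Z)
    (hz : ∀ᵐ x ∂(P.map M.latent), ∀ u : Fin N, ∀ s t : ℕ, s < t → t < T →
      A.item z x.rating u s ≠ A.item z x.rating u t) :
    1 / 160 * lowerBound N qU qI T ≤ ∫ x, A.cost T z x.rating ∂(P.map M.latent) := by
  obtain ⟨B, hB, h⟩ := A.exists_item_lt z T
  have hN0 : 0 < N := by omega
  have : IsProbabilityMeasure (P.map M.latent) :=
    Measure.isProbabilityMeasure_map M.measurable_latent.aemeasurable
  have : IsProbabilityMeasure ((P.map M.latent).map (Latent.restrict B)) :=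
    Measure.isProbabilityMeasure_map (Latent.measurable_restrict B).aemeasurable
  set E := A.exploration z T B hN0 hB h with hE
  have hinj : ∀ ω : Config (Fin N) (Fin B) (Fin qU) (Fin qI),
      Set.InjOn (fun k => E.pair k ω.rating) (range (T * N)) := by
    intro c
    obtain ⟨x, rfl, hx⟩ := exists_restrict_eq M hz B c
    refine A.exploration_injOn hN0 hB h _ fun u s t hst ht => ?_
    rw [A.item_restrict h x u (hst.trans ht), A.item_restrict h x u ht]
    exact hx u s t hst ht
  have hfin := lowerBound_mul_card_le hN hqUN hqU hqI hT
    (A.exploration_roundRobin hN0 hB h) hinj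
  have hint : ∫ x, A.cost T z x.rating ∂(P.map M.latent) =
      ∑ c : Config (Fin N) (Fin B) (Fin qU) (Fin qI),
        (Fintype.card (Config (Fin N) (Fin B) (Fin qU) (Fin qI)) : ℝ)⁻¹ *
          (E.dislikes c.rating (T * N) : ℝ) := by
    simp_rw [A.cost_eq hN0 hB h]
    rw [← integral_map (φ := Latent.restrict B) (Latent.measurable_restrict B).aemeasurable
      (f := fun c : Config (Fin N) (Fin B) (Fin qU) (Fin qI) =>
        (E.dislikes c.rating (T * N) : ℝ)) (measurable_of_finite _).aestronglyMeasurable,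
      integral_fintype (Integrable.of_finite)]
    refine sum_congr rfl fun c _ => ?_
    rw [real_map_restrict, smul_eq_mul]
  -- Any point of the latent space shows that there is a configuration, so the cardinality can be
  -- divided by.
  obtain ⟨x, -⟩ := hz.exists
  have hcard : (0 : ℝ) < Fintype.card (Config (Fin N) (Fin B) (Fin qU) (Fin qI)) := by
    exact_mod_cast Fintype.card_pos_iff.2 ⟨x.restrict B⟩
  rw [hint, ← mul_sum, inv_mul_eq_div, le_div_iff₀ hcard]
  linarith

end Main

end CollabFilter

end

theorem theoremt :
    ∃ c : ℝ, 0 < c ∧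
      ∀ N qU qI T : ℕ,
        100 < N →
        20 * (qU : ℝ) * (Real.logb 2 qU) ^ 2 < N →
        100 * Real.logb 2 N ≤ qU →
        100 * Real.logb 2 N ≤ qI →
        1 ≤ T →
        ∀ (Z : Type*) [MeasurableSpace Z] (Ω : Type*) [MeasurableSpace Ω]
          (P : Measure Ω) [IsProbabilityMeasure P]
          (M : CollabFilter.Model N qU qI Z P) (A : CollabFilter.Algorithm N Z),
          CollabFilter.NoRepeat M A T →
          c * CollabFilter.lowerBound N qU qI T ≤ (N : ℝ) * CollabFilter.regret M A T := by
  refine ⟨1 / 160, by norm_num, ?_⟩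
  intro N qU qI T hN hqUN hqU hqI hT Z _ Ω _ P _ M A hrep
  have hmeas : Measurable fun ω => (M.seeds ω, M.latent ω) :=
    M.measurable_seeds.prodMk M.measurable_latent
  have hmap := (indepFun_iff_map_prod_eq_prod_map_map M.measurable_seeds.aemeasurable
    M.measurable_latent.aemeasurable).1 M.indepFun_seeds_latent
  have : IsProbabilityMeasure (P.map M.latent) :=
    Measure.isProbabilityMeasure_map M.measurable_latent.aemeasurable
  have : IsProbabilityMeasure (P.map M.seeds) :=
    Measure.isProbabilityMeasure_map M.measurable_seeds.aemeasurable
  have hset : MeasurableSet {p : (Fin N → ℕ → Z) × CollabFilter.Latent N qU qI |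
      ∀ u : Fin N, ∀ s t : ℕ, s < t → t < T →
        A.item p.1 p.2.rating u s ≠ A.item p.1 p.2.rating u t} := by
    simp only [Set.ofPred_forall]
    refine MeasurableSet.iInter fun u => MeasurableSet.iInter fun s => MeasurableSet.iInter fun t =>
      MeasurableSet.iInter fun _ => MeasurableSet.iInter fun _ => ?_
    exact (measurableSet_eq_fun (A.measurable_item u s) (A.measurable_item u t)).compl
  -- By independence the joint law is a product, so Fubini passes the absence of repetitions to
  -- almost every fixed seed; the bound for fixed seeds is then integrated.
  have hae : ∀ᵐ z ∂(P.map M.seeds), ∀ᵐ x ∂(P.map M.latent),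
      ∀ u : Fin N, ∀ s t : ℕ, s < t → t < T →
        A.item z x.rating u s ≠ A.item z x.rating u t := by
    refine Measure.ae_ae_of_ae_prod (p := fun p : (Fin N → ℕ → Z) × CollabFilter.Latent N qU qI =>
      ∀ u : Fin N, ∀ s t : ℕ, s < t → t < T →
        A.item p.1 p.2.rating u s ≠ A.item p.1 p.2.rating u t) ?_
    rw [← hmap, ae_map_iff hmeas.aemeasurable hset]
    exact hrep
  have hcost := A.integrable_cost T ((P.map M.seeds).prod (P.map M.latent))
  rw [CollabFilter.mul_regret_eq M A (by omega) T,
    ← integral_map (φ := fun ω => (M.seeds ω, M.latent ω)) hmeas.aemeasurable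
      (f := fun p : (Fin N → ℕ → Z) × CollabFilter.Latent N qU qI => A.cost T p.1 p.2.rating)
      (A.measurable_cost T).aestronglyMeasurable, hmap, integral_prod _ hcost]
  calc 1 / 160 * CollabFilter.lowerBound N qU qI T
      = ∫ _z, 1 / 160 * CollabFilter.lowerBound N qU qI T ∂(P.map M.seeds) := by simp
    _ ≤ _ := integral_mono_ae (integrable_const _) hcost.integral_prod_left
        (hae.mono fun z hz => CollabFilter.le_integral_cost M A hN hqUN hqU hqI hT z hz)
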